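/- Let $D_s=\{z\in\mathbb C:|z|<s\}$ and $D=D_1$. For $E\subseteq\mathbb C$ let $H(E)$ be the set of functions analytic on (a neighbourhood of) $E$, and let $\omega(E)$ be the set of $f\in H(E)$ that are locally univalent in $E$ (injective in a neighbourhood of each point of $E$) with $f(0)=0$ and $f'(0)>0$. For an open set $U$, $H(U)$ carries the topology of locally uniform convergence. For $g$ on $\partial D$ put $$P[g](\xi)=\frac1{2\pi i}\int_{\partial D}g(z)\,\frac{z+\xi}{z-\xi}\,\frac{dz}{z},\qquad \xi\in D.$$ A strong* solution of $$f_t=\xi f'\,P\!\left[\frac1{|f'|^2}\right],\qquad \xi\in D,\tag{1}$$ on a time interval $I$ is a family $f(\cdot,t)\in\omega(\overline D)$, $t\in I$, that is continuously differentiable with respect to $t\in I$ and satisfies (1) for all $t\in I$; here $f'=\partial f/\partial\xi$ and $f_t=\partial f/\partial t$ (one-sided at endpoints of $I$). **Theorem (short-time existence of strong\* solutions).** Let $\rho_0>r>1$ and let $f_0\in\omega(\overline{D_r})\cap H(\overline{D_{\rho_0}})$. Then there exist $t_0>0$ and a strong* solution $f(\xi,t)$ of (1) on $[0,t_0]$ such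 that $f\in C^1([0,t_0],H(D_r))$, $f(\cdot,t)\in\omega(D_r)$ for every $t\in[0,t_0]$, and $f(\cdot,0)=f_0$ on $D_r$. -/

import Mathlib

open Set Filter Topology

noncomputable section

/-- `f` is univalent near every point of `E`. (Neighbourhoods are taken in `ℂ`: a function that is
analytic on a closed set `E` is by convention analytic on an open set containing `E`.) -/
def LocallyUnivalentOn (f : ℂ → ℂ) (E : Set ℂ) : Prop :=
  ∀ z ∈ E, ∃ U ∈ 𝓝 z, InjOn f U

/-- The class `ω(E)`: `f` is analytic on (a neighbourhood of) `E`, locally univalent in `E`,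
`f(0) = 0`, and `f'(0)` is a positive real number. -/
structure MemOmega (E : Set ℂ) (f : ℂ → ℂ) : Prop where
  analytic : AnalyticOnNhd ℂ f E
  locallyUnivalent : LocallyUnivalentOn f E
  map_zero : f 0 = 0
  deriv_zero_pos : ∃ a : ℝ, 0 < a ∧ deriv f 0 = (a : ℂ)

/-- `P[g](ξ) = (1 / 2πi) ∫_{∂D} g(z) (z + ξ) / (z - ξ) dz / z`, where `∂D` is the unit circle. -/
def schwarzP (g : ℂ → ℂ) (ξ : ℂ) : ℂ :=
  (2 * (Real.pi : ℂ) * Complex.I)⁻¹ * ∮ z in C(0, 1), g z * ((z + ξ) / (z - ξ)) / z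

/-- The right-hand side `ξ f'(ξ) P[1 / |f'|²](ξ)` of the evolution equation. -/
def pgRHS (f : ℂ → ℂ) (ξ : ℂ) : ℂ :=
  ξ * deriv f ξ * schwarzP (fun z => ((1 / ‖deriv f z‖ ^ 2 : ℝ) : ℂ)) ξ

/-- `f` is a strong* solution of `f_t = ξ f' P[1 / |f'|²]` on the time interval `I`: at each time
it belongs to `ω` of the closed unit disk, it is continuously differentiable in time, and it
satisfies the equation in the open unit disk. (`f t ξ` stands for `f(ξ, t)`.) -/
structure IsStrongStarSolution (I : Set ℝ) (f : ℝ → ℂ → ℂ) : Prop where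
  memOmega : ∀ t ∈ I, MemOmega (Metric.closedBall 0 1) (f t)
  contDiffOn : ∀ ξ ∈ Metric.closedBall (0 : ℂ) 1, ContDiffOn ℝ 1 (fun t => f t ξ) I
  equation : ∀ t ∈ I, ∀ ξ ∈ Metric.ball (0 : ℂ) 1,
    HasDerivWithinAt (fun s => f s ξ) (pgRHS (f t) ξ) I t

/-- `f ∈ C¹(I, H(U))` for a time interval `I` and an open set `U`, where `H(U)`, the space of
analytic functions on `U`, carries the topology of locally uniform convergence. -/
def IsC1Holomorphic (I : Set ℝ) (U : Set ℂ) (f : ℝ → ℂ → ℂ) : Prop :=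
  (∀ t ∈ I, AnalyticOnNhd ℂ (f t) U) ∧
    ∃ g : ℝ → ℂ → ℂ,
      (∀ t ∈ I, AnalyticOnNhd ℂ (g t) U) ∧
      (∀ t ∈ I, TendstoLocallyUniformlyOn
        (fun (s : ℝ) (ξ : ℂ) => (f s ξ - f t ξ) / ((s - t : ℝ) : ℂ)) (g t) (𝓝[I \ {t}] t) U) ∧
      (∀ t ∈ I, TendstoLocallyUniformlyOn g (g t) (𝓝[I] t) U)

end

/-!
With `w = 1 / f'` the equation reads `f_t = ξ P[|w|²] f'`; differentiating in `ξ` gives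
`w_t = ξ P[|w|²] w' - w (ξ P[|w|²])'`. By Schwarz's formula `P[|w|²]` extends analytically across
the unit circle, with Taylor coefficients bilinear in those of `w` and their conjugates. So there is
a formal solution `(f, w)` in powers of `t`. Each power of `t` costs one derivative in `ξ`, that is,
a factor `1 / δ` for a loss `δ` of radius in the scale of `ℓ¹` norms of Taylor coefficients, and as
in the Cauchy–Kovalevskaya theorem a majorant on this scale gives convergence for small `t`.
The relation `f' w = 1` keeps `f` locally univalent, and `f'(0, t)` remains positive because it
solves a linear equation with real coefficient `P[|w|²](0)`.
-/

open scoped PowerSeries ComplexConjugate ENNReal NNReal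

namespace PolubarinovaGalin

section WeightedNorm

variable {R : Type*} [Semiring R]

/-- A submultiplicative seminorm `N : R → [0, ∞]` on a semiring. The value `∞` is allowed, so that
no convergence has to be assumed of power series. -/
structure IsSubmulSeminorm (N : R → ℝ≥0∞) : Prop where
  map_zero : N 0 = 0
  map_add_le : ∀ a b, N (a + b) ≤ N a + N b
  map_mul_le : ∀ a b, N (a * b) ≤ N a * N b

/-- The weighted `ℓ¹` norm `∑ N(uₙ) sⁿ` of a power series whose coefficients are measured by `N`. -/
noncomputable def l1Norm (N : R → ℝ≥0∞) (s : ℝ≥0) (u : R⟦X⟧) : ℝ≥0∞ :=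
  ∑' n, N (PowerSeries.coeff n u) * (s : ℝ≥0∞) ^ n

variable {N : R → ℝ≥0∞}

theorem IsSubmulSeminorm.map_sum_le (hN : IsSubmulSeminorm N) {ι : Type*} (t : Finset ι)
    (a : ι → R) : N (∑ i ∈ t, a i) ≤ ∑ i ∈ t, N (a i) :=
  Finset.le_sum_of_subadditive N hN.map_zero.le hN.map_add_le t a

theorem IsSubmulSeminorm.map_coeff_mul_le (hN : IsSubmulSeminorm N) (u v : R⟦X⟧) (n : ℕ) :
    N (PowerSeries.coeff n (u * v)) ≤ ∑ p ∈ Finset.HasAntidiagonal.antidiagonal n,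
      N (PowerSeries.coeff p.1 u) * N (PowerSeries.coeff p.2 v) := by
  rw [PowerSeries.coeff_mul]
  exact (hN.map_sum_le _ _).trans (Finset.sum_le_sum fun p _ => hN.map_mul_le _ _)

theorem ennreal_tsum_mul_tsum_eq_tsum_sum_antidiagonal (a b : ℕ → ℝ≥0∞) :
    (∑' n, a n) * ∑' n, b n = ∑' n, ∑ p ∈ Finset.HasAntidiagonal.antidiagonal n, a p.1 * b p.2 := by
  calc (∑' n, a n) * ∑' n, b n
      = ∑' p : ℕ × ℕ, a p.1 * b p.2 := by
        rw [ENNReal.tsum_prod (f := fun i j => a i * b j), ← ENNReal.tsum_mul_right]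
        simp only [ENNReal.tsum_mul_left]
    _ = ∑' x : Σ n, Finset.HasAntidiagonal.antidiagonal n, a x.2.1.1 * b x.2.1.2 :=
        (Finset.HasAntidiagonal.sigmaAntidiagonalEquivProd.tsum_eq
          fun p : ℕ × ℕ => a p.1 * b p.2).symm
    _ = ∑' n, ∑ p ∈ Finset.HasAntidiagonal.antidiagonal n, a p.1 * b p.2 := by
        rw [ENNReal.tsum_sigma']
        exact tsum_congr fun n => Finset.tsum_subtype (Finset.HasAntidiagonal.antidiagonal n)
          fun p => a p.1 * b p.2

theorem isSubmulSeminorm_l1Norm (hN : IsSubmulSeminorm N) (s : ℝ≥0) :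
    IsSubmulSeminorm (l1Norm N s) where
  map_zero := by simp [l1Norm, hN.map_zero]
  map_add_le u v := by
    simp only [l1Norm, ← ENNReal.tsum_add, ← add_mul, map_add]
    gcongr
    exact hN.map_add_le _ _
  map_mul_le u v := by
    simp only [l1Norm, ennreal_tsum_mul_tsum_eq_tsum_sum_antidiagonal]
    refine ENNReal.tsum_le_tsum fun n =>
      (mul_le_mul_left (hN.map_coeff_mul_le u v n) _).trans_eq ?_
    rw [Finset.sum_mul]
    refine Finset.sum_congr rfl fun p hp => ?_
    rw [← Finset.HasAntidiagonal.mem_antidiagonal.mp hp, pow_add]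
    ring

theorem IsSubmulSeminorm.map_pow_le (hN : IsSubmulSeminorm N) (a : R) {n : ℕ} (hn : 1 ≤ n) :
    N (a ^ n) ≤ N a ^ n := by
  induction n, hn using Nat.le_induction with
  | base => simp
  | succ n hn ih =>
    rw [pow_succ, pow_succ]
    exact (hN.map_mul_le _ _).trans (by gcongr)

theorem isSubmulSeminorm_enorm : IsSubmulSeminorm (enorm : ℂ → ℝ≥0∞) :=
  ⟨enorm_zero, enorm_add_le, fun a b => (enorm_mul a b).le⟩

theorem enorm_natCast (n : ℕ) : ‖(n : ℂ)‖ₑ = n := by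
  rw [← ofReal_norm, Complex.norm_natCast, ENNReal.ofReal_natCast]

theorem isSubmulSeminorm_id : IsSubmulSeminorm (id : ℝ≥0∞ → ℝ≥0∞) :=
  ⟨rfl, fun _ _ => le_rfl, fun _ _ => le_rfl⟩

theorem l1Norm_mono_radius (N : R → ℝ≥0∞) {s s' : ℝ≥0} (h : s ≤ s') (u : R⟦X⟧) :
    l1Norm N s u ≤ l1Norm N s' u :=
  ENNReal.tsum_le_tsum fun n => by gcongr

theorem succ_mul_pow_mul_le_add_pow (s δ : ℝ≥0) (n : ℕ) :
    (n + 1) * s ^ n * δ ≤ (s + δ) ^ (n + 1) := by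
  induction n with
  | zero => simp
  | succ n ih =>
    calc ((n + 1 : ℕ) + 1) * s ^ (n + 1) * δ
        = s * ((n + 1) * s ^ n * δ) + δ * s ^ (n + 1) := by push_cast; ring
      _ ≤ s * (s + δ) ^ (n + 1) + δ * (s + δ) ^ (n + 1) := by
          gcongr
          exact le_self_add
      _ = (s + δ) ^ (n + 1 + 1) := by ring

theorem IsSubmulSeminorm.map_mul_natCast_le (hN : IsSubmulSeminorm N) (a : R) (n : ℕ) :
    N (a * n) ≤ N a * n := by
  simpa [← nsmul_eq_mul'] using hN.map_sum_le (Finset.range n) fun _ => a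

theorem l1Norm_derivative_mul_le {A : Type*} [CommSemiring A] {N : A → ℝ≥0∞}
    (hN : IsSubmulSeminorm N) (s δ : ℝ≥0) (u : A⟦X⟧) :
    l1Norm N s (d⁄dX A u) * δ ≤ l1Norm N (s + δ) u := by
  calc l1Norm N s (d⁄dX A u) * δ
      ≤ ∑' n, N (PowerSeries.coeff (n + 1) u) * (((n + 1) * s ^ n * δ : ℝ≥0) : ℝ≥0∞) := by
        rw [l1Norm, ← ENNReal.tsum_mul_right]
        refine ENNReal.tsum_le_tsum fun n => ?_
        have hn := hN.map_mul_natCast_le (PowerSeries.coeff (n + 1) u) (n + 1)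
        rw [PowerSeries.coeff_derivative, ← Nat.cast_succ]
        refine (mul_le_mul_left (mul_le_mul_left hn _) _).trans_eq ?_
        push_cast
        ring
    _ ≤ ∑' n, N (PowerSeries.coeff (n + 1) u) * (((s + δ) ^ (n + 1) : ℝ≥0) : ℝ≥0∞) :=
        ENNReal.tsum_le_tsum fun n => by gcongr; exact succ_mul_pow_mul_le_add_pow s δ n
    _ ≤ l1Norm N (s + δ) u := by
        simp only [ENNReal.coe_pow]
        exact ENNReal.tsum_comp_le_tsum_of_injective (add_left_injective 1)
          fun n => N (PowerSeries.coeff n u) * ((s + δ : ℝ≥0) : ℝ≥0∞) ^ n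

theorem l1Norm_derivative_ne_top {A : Type*} [CommSemiring A] {N : A → ℝ≥0∞}
    (hN : IsSubmulSeminorm N) {s s' : ℝ≥0} (h : s < s') {u : A⟦X⟧} (hu : l1Norm N s' u ≠ ∞) :
    l1Norm N s (d⁄dX A u) ≠ ∞ := by
  have hle := l1Norm_derivative_mul_le hN s (s' - s) u
  rw [add_tsub_cancel_of_le h.le] at hle
  exact (ENNReal.lt_top_of_mul_ne_top_left (ne_top_of_le_ne_top hu hle)
    (ENNReal.coe_ne_zero.mpr (tsub_pos_of_lt h).ne')).ne

end WeightedNorm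

section Majorants

/-- Cauchy's majorant relation `x ≪ y` between power series with coefficients in `[0, ∞]`. -/
def MajorizedBy (x y : ℝ≥0∞⟦X⟧) : Prop :=
  ∀ n, PowerSeries.coeff n x ≤ PowerSeries.coeff n y

theorem MajorizedBy.refl (x : ℝ≥0∞⟦X⟧) : MajorizedBy x x := fun _ => le_rfl

theorem MajorizedBy.trans {x y z : ℝ≥0∞⟦X⟧} (hxy : MajorizedBy x y) (hyz : MajorizedBy y z) :
    MajorizedBy x z :=
  fun n => (hxy n).trans (hyz n)

theorem MajorizedBy.add {x y x' y' : ℝ≥0∞⟦X⟧} (h : MajorizedBy x y) (h' : MajorizedBy x' y') :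
    MajorizedBy (x + x') (y + y') := fun n => by
  simpa only [map_add] using add_le_add (h n) (h' n)

theorem MajorizedBy.mul {x y x' y' : ℝ≥0∞⟦X⟧} (h : MajorizedBy x y) (h' : MajorizedBy x' y') :
    MajorizedBy (x * x') (y * y') := fun n => by
  simp only [PowerSeries.coeff_mul]
  gcongr
  exacts [h _, h' _]

theorem MajorizedBy.pow {x y : ℝ≥0∞⟦X⟧} (h : MajorizedBy x y) (p : ℕ) :
    MajorizedBy (x ^ p) (y ^ p) := by
  induction p with
  | zero => exact MajorizedBy.refl _
  | succ p ih => simpa only [pow_succ] using ih.mul h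

theorem majorizedBy_add_right (x y : ℝ≥0∞⟦X⟧) : MajorizedBy x (x + y) := fun n => by
  simp only [map_add, le_self_add]

theorem majorizedBy_add_left (x y : ℝ≥0∞⟦X⟧) : MajorizedBy y (x + y) := fun n => by
  simp only [map_add, le_add_self]

theorem MajorizedBy.l1Norm_le {x y : ℝ≥0∞⟦X⟧} (h : MajorizedBy x y) (τ : ℝ≥0) :
    l1Norm id τ x ≤ l1Norm id τ y :=
  ENNReal.tsum_le_tsum fun n => mul_le_mul_left (h n) _

theorem succ_succ_pow_le_three_mul (n : ℕ) (x : ℝ≥0) :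
    ((n + 2) * x) ^ (n + 1) ≤ 3 * ((n + 1) * x) ^ (n + 1) := by
  have hexp : (1 + 1 / (n + 1 : ℝ)) ^ (n + 1) ≤ 3 :=
    calc (1 + 1 / (n + 1 : ℝ)) ^ (n + 1)
        ≤ Real.exp (1 / (n + 1 : ℝ)) ^ (n + 1) := by
          gcongr
          exact (add_comm _ _).trans_le (Real.add_one_le_exp _)
      _ = Real.exp 1 := by
          rw [← Real.exp_nat_mul]
          congr 1
          push_cast
          field_simp
      _ ≤ 3 := Real.exp_one_lt_three.le
  have hsplit : ((n + 2) * x : ℝ) = (1 + 1 / (n + 1 : ℝ)) * ((n + 1) * x) := by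
    field_simp
    ring
  rw [← NNReal.coe_le_coe]
  push_cast
  rw [hsplit, mul_pow]
  gcongr

/-- The witness is `B_j = sup (coeff j (b s)) δ ^ j` over the admissible pairs `(s, δ)`. In the
recursion for `B_{j+1}` the derivative costs the fraction `δ / (j + 2)` of the shrinking `δ`; what
remains is `δ (j + 1) / (j + 2)`, and `((j + 2) / (j + 1)) ^ (j + 1) ≤ 3`. -/
theorem exists_recursive_majorant {s₀ R K M : ℝ≥0} {p : ℕ} (b : ℝ≥0 → ℝ≥0∞⟦X⟧)
    (hzero : ∀ s ≤ R, PowerSeries.coeff 0 (b s) ≤ M)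
    (hsucc : ∀ s δ, s₀ ≤ s → s + δ ≤ R → ∀ j : ℕ,
      (j + 1) * δ * PowerSeries.coeff (j + 1) (b s) ≤
        K * PowerSeries.coeff j (b (s + δ) ^ p)) :
    ∃ B : ℝ≥0∞⟦X⟧, PowerSeries.coeff 0 B ≤ M ∧
      (∀ j, PowerSeries.coeff (j + 1) B ≤ 3 * K * PowerSeries.coeff j (B ^ p)) ∧
      ∀ s δ, s₀ ≤ s → s + δ ≤ R → MajorizedBy (PowerSeries.rescale (δ : ℝ≥0∞) (b s)) B := by
  let B : ℝ≥0∞⟦X⟧ := PowerSeries.mk fun j =>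
    ⨆ (s : ℝ≥0) (δ : ℝ≥0) (_ : s₀ ≤ s) (_ : s + δ ≤ R), δ ^ j * PowerSeries.coeff j (b s)
  have hB : ∀ s δ, s₀ ≤ s → s + δ ≤ R →
      MajorizedBy (PowerSeries.rescale (δ : ℝ≥0∞) (b s)) B := fun s δ hs hδ j => by
    rw [PowerSeries.coeff_rescale, PowerSeries.coeff_mk]
    exact le_iSup₂_of_le s δ (le_iSup₂_of_le hs hδ le_rfl)
  refine ⟨B, ?_, fun j => ?_, hB⟩
  · rw [PowerSeries.coeff_mk]
    refine iSup₂_le fun s δ => iSup₂_le fun _ hδ => ?_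
    simpa using hzero s (le_self_add.trans hδ)
  · rw [PowerSeries.coeff_mk]
    refine iSup₂_le fun s δ => iSup₂_le fun hs hδ => ?_
    obtain ⟨ε, rfl⟩ : ∃ ε, δ = (j + 2) * ε := ⟨δ / (j + 2), by field_simp⟩
    have hsε : s + ε + (j + 1) * ε ≤ R := by convert hδ using 1; ring
    calc (((j + 2) * ε : ℝ≥0) : ℝ≥0∞) ^ (j + 1) * PowerSeries.coeff (j + 1) (b s)
        ≤ (3 * ((j + 1) * ε) ^ (j + 1) : ℝ≥0) * PowerSeries.coeff (j + 1) (b s) := by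
          gcongr
          exact_mod_cast succ_succ_pow_le_three_mul j ε
      _ = 3 * (((j + 1) * ε : ℝ≥0) : ℝ≥0∞) ^ j *
            ((j + 1) * ε * PowerSeries.coeff (j + 1) (b s)) := by
          push_cast
          ring
      _ ≤ 3 * (((j + 1) * ε : ℝ≥0) : ℝ≥0∞) ^ j *
            (K * PowerSeries.coeff j (b (s + ε) ^ p)) :=
          mul_le_mul_right (hsucc s ε hs (le_self_add.trans hsε) j) _
      _ = 3 * K * PowerSeries.coeff j
            (PowerSeries.rescale (((j + 1) * ε : ℝ≥0) : ℝ≥0∞) (b (s + ε)) ^ p) := by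
          rw [← map_pow, PowerSeries.coeff_rescale]
          ring
      _ ≤ 3 * K * PowerSeries.coeff j (B ^ p) := by
          gcongr
          exact (hB _ _ (hs.trans le_self_add) hsε).pow p j

theorem l1Norm_trunc (τ : ℝ≥0) (n : ℕ) (x : ℝ≥0∞⟦X⟧) :
    l1Norm id τ (PowerSeries.trunc n x) =
      ∑ j ∈ Finset.range n, PowerSeries.coeff j x * (τ : ℝ≥0∞) ^ j := by
  rw [l1Norm, tsum_eq_sum (s := Finset.range n) fun j hj => by
    simp [PowerSeries.coeff_trunc, Finset.mem_range.not.mp hj]]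
  refine Finset.sum_congr rfl fun j hj => ?_
  rw [Polynomial.coeff_coe, PowerSeries.coeff_trunc, if_pos (Finset.mem_range.mp hj), id]

theorem coeff_trunc_pow {n j : ℕ} (hj : j < n) (x : ℝ≥0∞⟦X⟧) (p : ℕ) :
    PowerSeries.coeff j ((PowerSeries.trunc n x : ℝ≥0∞⟦X⟧) ^ p) = PowerSeries.coeff j (x ^ p) := by
  rw [← PowerSeries.coeff_coe_trunc_of_lt hj, PowerSeries.trunc_trunc_pow,
    PowerSeries.coeff_coe_trunc_of_lt hj]

theorem l1Norm_le_two_mul_of_recursive {B : ℝ≥0∞⟦X⟧} {p : ℕ} {τ c M : ℝ≥0} (hp : 1 ≤ p)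
    (hzero : PowerSeries.coeff 0 B ≤ M)
    (hsucc : ∀ j, PowerSeries.coeff (j + 1) B ≤ c * PowerSeries.coeff j (B ^ p))
    (hτ : c * τ * (2 * M) ^ p ≤ M) :
    l1Norm id τ B ≤ 2 * M := by
  refine ENNReal.tsum_le_of_sum_range_le fun n => ?_
  induction n with
  | zero => simp
  | succ n ih =>
    let T : ℝ≥0∞⟦X⟧ := PowerSeries.trunc n B
    have hTnorm : l1Norm id τ T ≤ 2 * M := (l1Norm_trunc τ n B).trans_le ih
    calc ∑ j ∈ Finset.range (n + 1), id (PowerSeries.coeff j B) * (τ : ℝ≥0∞) ^ j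
        = ∑ j ∈ Finset.range n, PowerSeries.coeff (j + 1) B * (τ : ℝ≥0∞) ^ (j + 1) +
            PowerSeries.coeff 0 B := by
          rw [Finset.sum_range_succ']
          simp only [id, pow_zero, mul_one]
      _ ≤ ∑ j ∈ Finset.range n, c * PowerSeries.coeff j (T ^ p) * (τ : ℝ≥0∞) ^ (j + 1) + M := by
          gcongr with j hj
          exact (hsucc j).trans_eq (by rw [coeff_trunc_pow (Finset.mem_range.mp hj)])
      _ = c * τ * ∑ j ∈ Finset.range n, id (PowerSeries.coeff j (T ^ p)) * (τ : ℝ≥0∞) ^ j + M := by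
          rw [Finset.mul_sum]
          simp only [id, pow_succ]
          congr 1
          exact Finset.sum_congr rfl fun j _ => by ring
      _ ≤ c * τ * l1Norm id τ (T ^ p) + M := by
          gcongr
          exact ENNReal.sum_le_tsum _
      _ ≤ c * τ * (2 * M) ^ p + M := by
          gcongr
          exact ((isSubmulSeminorm_l1Norm isSubmulSeminorm_id τ).map_pow_le T hp).trans
            (pow_le_pow_left' hTnorm p)
      _ ≤ M + M := by
          gcongr
          exact_mod_cast hτ
      _ = 2 * M := (two_mul _).symm

theorem l1Norm_id_rescale (τ δ : ℝ≥0) (x : ℝ≥0∞⟦X⟧) :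
    l1Norm id τ (PowerSeries.rescale (δ : ℝ≥0∞) x) = l1Norm id (δ * τ) x :=
  tsum_congr fun n => by
    rw [id, id, PowerSeries.coeff_rescale, ENNReal.coe_mul, mul_pow]
    ring

theorem exists_l1Norm_le_of_scale {s₀ R K M : ℝ≥0} {p : ℕ} (hp : 1 ≤ p) (hM : 0 < M)
    (b : ℝ≥0 → ℝ≥0∞⟦X⟧) (hzero : ∀ s ≤ R, PowerSeries.coeff 0 (b s) ≤ M)
    (hsucc : ∀ s δ, s₀ ≤ s → s + δ ≤ R → ∀ j : ℕ,
      (j + 1) * δ * PowerSeries.coeff (j + 1) (b s) ≤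
        K * PowerSeries.coeff j (b (s + δ) ^ p)) :
    ∃ τ : ℝ≥0, 0 < τ ∧ ∀ s δ, s₀ ≤ s → s + δ ≤ R → l1Norm id (δ * τ) (b s) ≤ 2 * M := by
  obtain ⟨B, hB0, hB, hbB⟩ := exists_recursive_majorant b hzero hsucc
  let τ : ℝ≥0 := M / ((3 * K + 1) * (2 * M) ^ p)
  have hτ : 3 * K * τ * (2 * M) ^ p ≤ M :=
    calc 3 * K * τ * (2 * M) ^ p ≤ (3 * K + 1) * τ * (2 * M) ^ p := by
          gcongr
          exact le_self_add
      _ = M := by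
          simp only [τ]
          field_simp
  refine ⟨τ, by positivity, fun s δ hs hδ => ?_⟩
  rw [← l1Norm_id_rescale]
  exact ((hbB s δ hs hδ).l1Norm_le τ).trans
    (l1Norm_le_two_mul_of_recursive hp hB0 (by exact_mod_cast hB) hτ)

end Majorants

section FormalSolution

theorem exists_fixedPoint_of_X_pow_dvd {R : Type*} [Ring R] (T : R⟦X⟧ → R⟦X⟧)
    (hT : ∀ n x y, (PowerSeries.X : R⟦X⟧) ^ n ∣ x - y → PowerSeries.X ^ (n + 1) ∣ T x - T y) :
    ∃ x, T x = x := by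
  have hstep : ∀ n, (PowerSeries.X : R⟦X⟧) ^ n ∣ T^[n + 1] 0 - T^[n] 0 := fun n => by
    induction n with
    | zero => simp
    | succ n ih =>
      simpa only [Function.iterate_succ_apply'] using hT n _ _ ih
  have hstable : ∀ k n, k < n →
      PowerSeries.coeff k (T^[n] 0) = PowerSeries.coeff k (T^[k + 1] 0) := fun k n hkn => by
    induction n, hkn using Nat.le_induction with
    | base => rfl
    | succ n hkn ih =>
      rw [← ih, ← sub_eq_zero, ← map_sub]
      exact PowerSeries.X_pow_dvd_iff.mp (hstep n) k hkn
  let x : R⟦X⟧ := PowerSeries.mk fun k => PowerSeries.coeff k (T^[k + 1] 0)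
  have hx : ∀ n, PowerSeries.X ^ n ∣ x - T^[n] 0 := fun n =>
    PowerSeries.X_pow_dvd_iff.mpr fun k hk => by
      rw [map_sub, PowerSeries.coeff_mk, hstable k n hk, sub_self]
  refine ⟨x, PowerSeries.ext fun k => ?_⟩
  have hk : PowerSeries.X ^ (k + 1) ∣ T x - x := by
    have h := dvd_sub (hT k _ _ (hx k)) (hx (k + 1))
    rwa [Function.iterate_succ_apply', sub_sub_sub_cancel_right] at h
  rw [← sub_eq_zero, ← map_sub]
  exact PowerSeries.X_pow_dvd_iff.mp hk k k.lt_succ_self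

theorem exists_derivative_eq_of_X_pow_dvd {R : Type*} [CommRing R] [Algebra ℚ R]
    (Φ : R⟦X⟧ → R⟦X⟧)
    (hΦ : ∀ n x y, (PowerSeries.X : R⟦X⟧) ^ n ∣ x - y → PowerSeries.X ^ n ∣ Φ x - Φ y) (a : R) :
    ∃ x, PowerSeries.coeff 0 x = a ∧ d⁄dX R x = Φ x := by
  let T : R⟦X⟧ → R⟦X⟧ := fun x => PowerSeries.mk fun n =>
    n.casesOn a fun k => ((k + 1 : ℚ)⁻¹ : ℚ) • PowerSeries.coeff k (Φ x)
  obtain ⟨x, hx⟩ := exists_fixedPoint_of_X_pow_dvd T fun n x y hxy =>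
    PowerSeries.X_pow_dvd_iff.mpr fun m hm => by
      cases m with
      | zero => simp [T]
      | succ k =>
        simp only [T, map_sub, PowerSeries.coeff_mk, ← smul_sub]
        rw [← map_sub, PowerSeries.X_pow_dvd_iff.mp (hΦ n x y hxy) k (Nat.lt_of_succ_lt_succ hm),
          smul_zero]
  refine ⟨x, hx ▸ PowerSeries.coeff_mk _ _, PowerSeries.ext fun k => ?_⟩
  have hk : PowerSeries.coeff (k + 1) x = ((k + 1 : ℚ)⁻¹ : ℚ) • PowerSeries.coeff k (Φ x) := by
    conv_lhs => rw [← hx]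
    exact PowerSeries.coeff_mk _ _
  rw [PowerSeries.coeff_derivative, hk, Algebra.smul_def, mul_comm, ← mul_assoc,
    show (k + 1 : R) = algebraMap ℚ R (k + 1) by simp, ← map_mul,
    mul_inv_cancel₀ k.cast_add_one_ne_zero, map_one, one_mul]

theorem X_pow_dvd_ringInverse_sub {R : Type*} [CommRing R] {n : ℕ} {x y : R⟦X⟧}
    (h : PowerSeries.X ^ n ∣ x - y) : PowerSeries.X ^ n ∣ Ring.inverse x - Ring.inverse y := by
  rcases eq_or_ne n 0 with rfl | hn
  · simp
  have hconst : PowerSeries.constantCoeff x = PowerSeries.constantCoeff y := by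
    rw [← sub_eq_zero, ← map_sub]
    exact PowerSeries.X_dvd_iff.mp ((dvd_pow_self _ hn).trans h)
  have hunit : IsUnit x ↔ IsUnit y := by
    rw [PowerSeries.isUnit_iff_constantCoeff, hconst, PowerSeries.isUnit_iff_constantCoeff]
  by_cases hx : IsUnit x
  · have hdiff : Ring.inverse x - Ring.inverse y =
        (x - y) * -(Ring.inverse x * Ring.inverse y) := by
      linear_combination Ring.inverse y * Ring.mul_inverse_cancel x hx -
        Ring.inverse x * Ring.mul_inverse_cancel y (hunit.mp hx)
    exact hdiff ▸ h.mul_right _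
  · rw [Ring.inverse_non_unit x hx, Ring.inverse_non_unit y (hunit.not.mp hx), sub_self]
    exact dvd_zero _

/-- The derivation of `A⟦X⟧` that applies a derivation `D` of `A` to every coefficient. For
`A = ℂ⟦X⟧` and `D = d⁄dX ℂ` it is `∂/∂ξ` on power series in the time variable whose coefficients
are power series in `ξ`. -/
noncomputable def coeffwiseDerivation {R A : Type*} [CommRing R] [CommRing A] [Algebra R A]
    (D : Derivation R A A) : Derivation R A⟦X⟧ A⟦X⟧ :=
  Derivation.mk'
    { toFun := fun x => PowerSeries.mk fun n => D (PowerSeries.coeff n x)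
      map_add' := fun x y => PowerSeries.ext fun n => by simp
      map_smul' := fun r x => PowerSeries.ext fun n => by simp }
    fun x y => PowerSeries.ext fun n => by
      simp only [LinearMap.coe_mk, AddHom.coe_mk, PowerSeries.coeff_mk, smul_eq_mul, map_add,
        PowerSeries.coeff_mul, map_sum, Derivation.leibniz, Finset.sum_add_distrib]
      congr 1
      exact Finset.Nat.sum_antidiagonal_swap
        (f := fun p => PowerSeries.coeff p.1 y * D (PowerSeries.coeff p.2 x))

@[simp]
theorem coeff_coeffwiseDerivation {R A : Type*} [CommRing R] [CommRing A] [Algebra R A]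
    (D : Derivation R A A) (x : A⟦X⟧) (n : ℕ) :
    PowerSeries.coeff n (coeffwiseDerivation D x) = D (PowerSeries.coeff n x) := by
  rw [coeffwiseDerivation, Derivation.coe_mk']
  exact PowerSeries.coeff_mk n fun n => D (PowerSeries.coeff n x)

theorem coeffwiseDerivation_derivative {R A : Type*} [CommRing R] [CommRing A] [Algebra R A]
    (D : Derivation R A A) (x : A⟦X⟧) :
    coeffwiseDerivation D (d⁄dX A x) = d⁄dX A (coeffwiseDerivation D x) :=
  PowerSeries.ext fun n => by
    simp only [coeff_coeffwiseDerivation, PowerSeries.coeff_derivative, Derivation.leibniz,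
      map_add, Derivation.map_natCast, Derivation.map_one_eq_zero]
    simp [mul_comm]

theorem X_pow_dvd_coeffwiseDerivation_sub {R A : Type*} [CommRing R] [CommRing A] [Algebra R A]
    (D : Derivation R A A) {n : ℕ} {x y : A⟦X⟧} (h : PowerSeries.X ^ n ∣ x - y) :
    PowerSeries.X ^ n ∣ coeffwiseDerivation D x - coeffwiseDerivation D y :=
  PowerSeries.X_pow_dvd_iff.mpr fun m hm => by
    rw [← map_sub, coeff_coeffwiseDerivation, PowerSeries.X_pow_dvd_iff.mp h m hm, map_zero]

/-- The power series `h₀ + 2 ∑ hₖ ξᵏ`, where `∑ hₖ zᵏ` is the Fourier series on the unit circle of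
`u * conj v`: the completion to an analytic function of the disc used in Schwarz's formula. -/
noncomputable def schwarzPair (u v : ℂ⟦X⟧) : ℂ⟦X⟧ :=
  PowerSeries.mk fun k =>
    (if k = 0 then 1 else 2) * ∑' m, PowerSeries.coeff (m + k) u * conj (PowerSeries.coeff m v)

/-- The expansion in powers of the time variable of `schwarzPair w w`, where the time variable is
treated as real, i.e. `schwarzPair` is extended bilinearly. -/
noncomputable def schwarzSeries (w : ℂ⟦X⟧⟦X⟧) : ℂ⟦X⟧⟦X⟧ :=
  PowerSeries.mk fun j => ∑ p ∈ Finset.HasAntidiagonal.antidiagonal j,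
    schwarzPair (PowerSeries.coeff p.1 w) (PowerSeries.coeff p.2 w)

theorem X_pow_dvd_schwarzSeries_sub {n : ℕ} {x y : ℂ⟦X⟧⟦X⟧} (h : PowerSeries.X ^ n ∣ x - y) :
    PowerSeries.X ^ n ∣ schwarzSeries x - schwarzSeries y := by
  have hcoeff : ∀ m < n, PowerSeries.coeff m x = PowerSeries.coeff m y := fun m hm => by
    rw [← sub_eq_zero, ← map_sub, PowerSeries.X_pow_dvd_iff.mp h m hm]
  refine PowerSeries.X_pow_dvd_iff.mpr fun m hm => ?_
  rw [map_sub, schwarzSeries, schwarzSeries, PowerSeries.coeff_mk, PowerSeries.coeff_mk,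
    sub_eq_zero]
  refine Finset.sum_congr rfl fun p hp => ?_
  have hp' := Finset.HasAntidiagonal.mem_antidiagonal.mp hp
  rw [hcoeff p.1 (by omega), hcoeff p.2 (by omega)]

/-- The derivation `∂/∂ξ` on power series in the time variable over `ℂ⟦ξ⟧`. -/
noncomputable abbrev xiDeriv : Derivation ℂ ℂ⟦X⟧⟦X⟧ ℂ⟦X⟧⟦X⟧ := coeffwiseDerivation (d⁄dX ℂ)

/-- The power series of `ξ P[|w|²]`, the speed at which equation (1) transports `f` and `1 / f'`. -/
noncomputable def speedSeries (w : ℂ⟦X⟧⟦X⟧) : ℂ⟦X⟧⟦X⟧ :=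
  PowerSeries.C PowerSeries.X * schwarzSeries w

theorem derivative_reciprocal_xiDeriv {f w v : ℂ⟦X⟧⟦X⟧} (hfw : xiDeriv f * w = 1)
    (hf : d⁄dX ℂ⟦X⟧ f = v * xiDeriv f) :
    d⁄dX ℂ⟦X⟧ w = v * xiDeriv w - w * xiDeriv v := by
  have htime : xiDeriv f * d⁄dX ℂ⟦X⟧ w + w * d⁄dX ℂ⟦X⟧ (xiDeriv f) = 0 := by
    simpa using congrArg (d⁄dX ℂ⟦X⟧) hfw
  have hspace : xiDeriv f * xiDeriv w + w * xiDeriv (xiDeriv f) = 0 := by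
    simpa using congrArg xiDeriv hfw
  have hmixed : d⁄dX ℂ⟦X⟧ (xiDeriv f) = v * xiDeriv (xiDeriv f) + xiDeriv f * xiDeriv v := by
    rw [← coeffwiseDerivation_derivative, hf, Derivation.leibniz, smul_eq_mul, smul_eq_mul]
  rw [hmixed] at htime
  linear_combination w * htime - w * v * hspace +
    (v * xiDeriv w - w * xiDeriv v - d⁄dX ℂ⟦X⟧ w) * hfw

/-- The equation in the form `f_t = ξ f' P[|w|²]` with `w = 1 / f'`, together with the equation for
`w` that follows from it; the pair is closed under the estimates, while `f` alone is not. -/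
theorem exists_formal_solution {f₀ w₀ : ℂ⟦X⟧} (h₀ : d⁄dX ℂ f₀ * w₀ = 1) :
    ∃ f w : ℂ⟦X⟧⟦X⟧, PowerSeries.coeff 0 f = f₀ ∧ PowerSeries.coeff 0 w = w₀ ∧
      xiDeriv f * w = 1 ∧ d⁄dX ℂ⟦X⟧ f = speedSeries w * xiDeriv f ∧
      d⁄dX ℂ⟦X⟧ w = speedSeries w * xiDeriv w - w * xiDeriv (speedSeries w) := by
  obtain ⟨f, hf₀, hf⟩ := exists_derivative_eq_of_X_pow_dvd
    (fun f => speedSeries (Ring.inverse (xiDeriv f)) * xiDeriv f)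
    (fun n x y hxy => by
      have hxi := X_pow_dvd_coeffwiseDerivation_sub (d⁄dX ℂ) hxy
      refine dvd_mul_sub_mul ?_ hxi
      rw [speedSeries, speedSeries, ← mul_sub]
      exact (X_pow_dvd_schwarzSeries_sub (X_pow_dvd_ringInverse_sub hxi)).mul_left _) f₀
  have hconst : PowerSeries.constantCoeff (xiDeriv f) = d⁄dX ℂ f₀ := by
    rw [← PowerSeries.coeff_zero_eq_constantCoeff_apply, coeff_coeffwiseDerivation, hf₀]
  have hunit : IsUnit (xiDeriv f) :=
    PowerSeries.isUnit_iff_constantCoeff.mpr (hconst ▸ IsUnit.of_mul_eq_one _ h₀)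
  have hfw := Ring.mul_inverse_cancel _ hunit
  refine ⟨f, Ring.inverse (xiDeriv f), hf₀, ?_, hfw, hf, derivative_reciprocal_xiDeriv hfw hf⟩
  have hconst_mul := congrArg PowerSeries.constantCoeff hfw
  rw [map_mul, hconst, map_one] at hconst_mul
  rw [PowerSeries.coeff_zero_eq_constantCoeff_apply]
  exact (left_inv_eq_right_inv (mul_comm w₀ _ ▸ h₀) hconst_mul).symm

end FormalSolution

section Convergence

/-- The power series whose coefficients are the sizes of those of `x`. -/
noncomputable def coeffNorms {R : Type*} [Semiring R] (N : R → ℝ≥0∞) (x : R⟦X⟧) : ℝ≥0∞⟦X⟧ :=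
  PowerSeries.mk fun n => N (PowerSeries.coeff n x)

theorem l1Norm_id_coeffNorms {R : Type*} [Semiring R] (N : R → ℝ≥0∞) (τ : ℝ≥0) (x : R⟦X⟧) :
    l1Norm id τ (coeffNorms N x) = l1Norm N τ x :=
  tsum_congr fun n => by rw [id, coeffNorms, PowerSeries.coeff_mk]

theorem IsSubmulSeminorm.coeffNorms_mul {R : Type*} [Semiring R] {N : R → ℝ≥0∞}
    (hN : IsSubmulSeminorm N) (x y : R⟦X⟧) :
    MajorizedBy (coeffNorms N (x * y)) (coeffNorms N x * coeffNorms N y) := fun n => by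
  rw [PowerSeries.coeff_mul]
  simpa only [coeffNorms, PowerSeries.coeff_mk] using hN.map_coeff_mul_le x y n

theorem isSubmulSeminorm_l1Norm_enorm (s : ℝ≥0) :
    IsSubmulSeminorm (l1Norm (enorm : ℂ → ℝ≥0∞) s) :=
  isSubmulSeminorm_l1Norm isSubmulSeminorm_enorm s

theorem l1Norm_enorm_sub_le (s : ℝ≥0) (u v : ℂ⟦X⟧) :
    l1Norm enorm s (u - v) ≤ l1Norm enorm s u + l1Norm enorm s v := by
  have hneg : l1Norm enorm s (-v) = l1Norm enorm s v := by simp [l1Norm]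
  rw [sub_eq_add_neg, ← hneg]
  exact (isSubmulSeminorm_l1Norm_enorm s).map_add_le u (-v)

theorem l1Norm_X (s : ℝ≥0) : l1Norm (enorm : ℂ → ℝ≥0∞) s PowerSeries.X = s := by
  rw [l1Norm, tsum_eq_single 1 fun n hn => by simp [PowerSeries.coeff_X, hn]]
  simp

theorem l1Norm_mul_natCast (s : ℝ≥0) (u : ℂ⟦X⟧) (n : ℕ) :
    l1Norm enorm s (u * (n : ℂ⟦X⟧)) = l1Norm enorm s u * n := by
  rw [l1Norm, l1Norm, ← ENNReal.tsum_mul_right]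
  refine tsum_congr fun k => ?_
  rw [← map_natCast (PowerSeries.C (R := ℂ)), PowerSeries.coeff_mul_C, enorm_mul, enorm_natCast]
  ring

theorem l1Norm_schwarzPair_le {s : ℝ≥0} (hs : 1 ≤ s) (u v : ℂ⟦X⟧) :
    l1Norm enorm s (schwarzPair u v) ≤ 2 * (l1Norm enorm s u * l1Norm enorm s v) := by
  have hs' : (1 : ℝ≥0∞) ≤ s := by exact_mod_cast hs
  let a : ℕ → ℝ≥0∞ := fun n => ‖PowerSeries.coeff n u‖ₑ
  let b : ℕ → ℝ≥0∞ := fun n => ‖PowerSeries.coeff n v‖ₑ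
  have hcoeff : ∀ k, ‖PowerSeries.coeff k (schwarzPair u v)‖ₑ ≤ 2 * ∑' m, a (m + k) * b m :=
    fun k => by
      have htwo : ‖(if k = 0 then 1 else 2 : ℂ)‖ₑ ≤ 2 := by
        split_ifs
        · simp
        · exact (enorm_natCast 2).le
      rw [schwarzPair, PowerSeries.coeff_mk, enorm_mul]
      refine mul_le_mul' htwo (enorm_tsum_le_tsum_enorm.trans_eq (tsum_congr fun m => ?_))
      rw [enorm_mul, RCLike.enorm_conj]
  calc l1Norm enorm s (schwarzPair u v)
      ≤ ∑' k, (2 * ∑' m, a (m + k) * b m) * (s : ℝ≥0∞) ^ k :=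
        ENNReal.tsum_le_tsum fun k => mul_le_mul_left (hcoeff k) _
    _ = 2 * ∑' m, ∑' k, a (m + k) * b m * (s : ℝ≥0∞) ^ k := by
        rw [ENNReal.tsum_comm, ← ENNReal.tsum_mul_left]
        exact tsum_congr fun k => by rw [mul_assoc, ← ENNReal.tsum_mul_right]
    _ ≤ 2 * ∑' m, b m * (s : ℝ≥0∞) ^ m * l1Norm enorm s u := by
        gcongr with m
        calc ∑' k, a (m + k) * b m * (s : ℝ≥0∞) ^ k
            ≤ ∑' k, b m * (s : ℝ≥0∞) ^ m * (a (m + k) * (s : ℝ≥0∞) ^ (m + k)) :=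
              ENNReal.tsum_le_tsum fun k => by
                calc a (m + k) * b m * (s : ℝ≥0∞) ^ k
                    ≤ a (m + k) * b m * (s : ℝ≥0∞) ^ k * ((s : ℝ≥0∞) ^ m * (s : ℝ≥0∞) ^ m) :=
                      le_mul_of_one_le_right' (one_le_mul (one_le_pow₀ hs') (one_le_pow₀ hs'))
                  _ = b m * (s : ℝ≥0∞) ^ m * (a (m + k) * (s : ℝ≥0∞) ^ (m + k)) := by
                      rw [pow_add]
                      ring
          _ ≤ b m * (s : ℝ≥0∞) ^ m * l1Norm enorm s u := by
              rw [ENNReal.tsum_mul_left]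
              gcongr
              exact ENNReal.tsum_comp_le_tsum_of_injective (add_right_injective m)
                fun n => a n * (s : ℝ≥0∞) ^ n
    _ = 2 * (l1Norm enorm s u * l1Norm enorm s v) := by
        rw [ENNReal.tsum_mul_right, mul_comm (l1Norm enorm s u)]
        rfl

theorem coeffNorms_mono_radius {s s' : ℝ≥0} (h : s ≤ s') (x : ℂ⟦X⟧⟦X⟧) :
    MajorizedBy (coeffNorms (l1Norm enorm s) x) (coeffNorms (l1Norm enorm s') x) := fun n => by
  simpa only [coeffNorms, PowerSeries.coeff_mk] using l1Norm_mono_radius enorm h _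

theorem coeffNorms_schwarzSeries {s : ℝ≥0} (hs : 1 ≤ s) (w : ℂ⟦X⟧⟦X⟧) :
    MajorizedBy (coeffNorms (l1Norm enorm s) (schwarzSeries w))
      (2 * coeffNorms (l1Norm enorm s) w ^ 2) := fun n => by
  rw [two_mul, map_add, ← two_mul, pow_two, PowerSeries.coeff_mul, Finset.mul_sum]
  simp only [coeffNorms, schwarzSeries, PowerSeries.coeff_mk]
  refine ((isSubmulSeminorm_l1Norm_enorm s).map_sum_le _ _).trans ?_
  exact Finset.sum_le_sum fun p _ => l1Norm_schwarzPair_le hs _ _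

theorem coeffNorms_speedSeries {s : ℝ≥0} (hs : 1 ≤ s) (w : ℂ⟦X⟧⟦X⟧) :
    MajorizedBy (coeffNorms (l1Norm enorm s) (speedSeries w))
      (PowerSeries.C (2 * (s : ℝ≥0∞)) * coeffNorms (l1Norm enorm s) w ^ 2) := fun n => by
  have hmul : PowerSeries.coeff n (coeffNorms (l1Norm enorm s) (speedSeries w)) ≤
      s * PowerSeries.coeff n (coeffNorms (l1Norm enorm s) (schwarzSeries w)) := by
    simpa only [coeffNorms, speedSeries, PowerSeries.coeff_C_mul, PowerSeries.coeff_mk, l1Norm_X]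
      using (isSubmulSeminorm_l1Norm_enorm s).map_mul_le PowerSeries.X _
  refine hmul.trans ((mul_le_mul_right (coeffNorms_schwarzSeries hs w n) _).trans_eq ?_)
  rw [two_mul, map_add, PowerSeries.coeff_C_mul]
  ring

theorem l1Norm_schwarzSeries_ne_top {s τ : ℝ≥0} (hs : 1 ≤ s) {w : ℂ⟦X⟧⟦X⟧}
    (hw : l1Norm (l1Norm enorm s) τ w ≠ ∞) :
    l1Norm (l1Norm enorm s) τ (schwarzSeries w) ≠ ∞ := by
  have hN := isSubmulSeminorm_l1Norm isSubmulSeminorm_id τ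
  rw [← l1Norm_id_coeffNorms] at hw ⊢
  have hsq := ne_top_of_le_ne_top (ENNReal.pow_ne_top hw)
    (hN.map_pow_le (coeffNorms (l1Norm enorm s) w) one_le_two)
  refine ne_top_of_le_ne_top ?_ ((coeffNorms_schwarzSeries hs w).l1Norm_le τ)
  rw [two_mul]
  exact ne_top_of_le_ne_top (ENNReal.add_ne_top.mpr ⟨hsq, hsq⟩) (hN.map_add_le _ _)

theorem coeffNorms_mul_xiDeriv (s δ : ℝ≥0) (x y : ℂ⟦X⟧⟦X⟧) :
    MajorizedBy (PowerSeries.C (δ : ℝ≥0∞) * coeffNorms (l1Norm enorm s) (x * xiDeriv y))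
      (coeffNorms (l1Norm enorm (s + δ)) x * coeffNorms (l1Norm enorm (s + δ)) y) := by
  have hderiv : MajorizedBy
      (PowerSeries.C (δ : ℝ≥0∞) * coeffNorms (l1Norm enorm s) (xiDeriv y))
      (coeffNorms (l1Norm enorm (s + δ)) y) := fun n => by
    simp only [coeffNorms, PowerSeries.coeff_C_mul, PowerSeries.coeff_mk,
      coeff_coeffwiseDerivation]
    rw [mul_comm]
    exact l1Norm_derivative_mul_le isSubmulSeminorm_enorm s δ _
  refine ((MajorizedBy.refl _).mul
    ((isSubmulSeminorm_l1Norm_enorm s).coeffNorms_mul x (xiDeriv y))).trans ?_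
  rw [mul_left_comm]
  exact (coeffNorms_mono_radius le_self_add x).mul hderiv

theorem succ_mul_coeff_coeffNorms (s : ℝ≥0) (x : ℂ⟦X⟧⟦X⟧) (j : ℕ) :
    (j + 1) * PowerSeries.coeff (j + 1) (coeffNorms (l1Norm enorm s) x) =
      PowerSeries.coeff j (coeffNorms (l1Norm enorm s) (d⁄dX ℂ⟦X⟧ x)) := by
  rw [coeffNorms, coeffNorms, PowerSeries.coeff_mk, PowerSeries.coeff_mk,
    PowerSeries.coeff_derivative, ← Nat.cast_succ (R := ℂ⟦X⟧), l1Norm_mul_natCast, Nat.cast_succ,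
    mul_comm]

theorem coeffNorms_formal_solution {f w : ℂ⟦X⟧⟦X⟧} {s δ R : ℝ≥0} (hs : 1 ≤ s) (hR : s + δ ≤ R)
    (hf : d⁄dX ℂ⟦X⟧ f = speedSeries w * xiDeriv f)
    (hw : d⁄dX ℂ⟦X⟧ w = speedSeries w * xiDeriv w - w * xiDeriv (speedSeries w)) :
    MajorizedBy
      (PowerSeries.C (δ : ℝ≥0∞) * (coeffNorms (l1Norm enorm s) (d⁄dX ℂ⟦X⟧ f) +
        coeffNorms (l1Norm enorm s) (d⁄dX ℂ⟦X⟧ w)))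
      (PowerSeries.C (6 * R : ℝ≥0∞) * (coeffNorms (l1Norm enorm (s + δ)) f +
        coeffNorms (l1Norm enorm (s + δ)) w) ^ 3) := by
  set F := coeffNorms (l1Norm enorm (s + δ)) f
  set W := coeffNorms (l1Norm enorm (s + δ)) w
  set V := coeffNorms (l1Norm enorm (s + δ)) (speedSeries w)
  have hF : MajorizedBy F (F + W) := majorizedBy_add_right F W
  have hW : MajorizedBy W (F + W) := majorizedBy_add_left F W
  have hV : MajorizedBy V (PowerSeries.C (2 * R : ℝ≥0∞) * (F + W) ^ 2) := by
    refine (coeffNorms_speedSeries (hs.trans le_self_add) w).trans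
      (MajorizedBy.mul (fun n => ?_) (hW.pow 2))
    rw [PowerSeries.coeff_C, PowerSeries.coeff_C]
    split_ifs
    · gcongr
    · exact le_rfl
  have hw' : MajorizedBy (PowerSeries.C (δ : ℝ≥0∞) * coeffNorms (l1Norm enorm s) (d⁄dX ℂ⟦X⟧ w))
      (V * W + W * V) := by
    have hsub : MajorizedBy (coeffNorms (l1Norm enorm s) (d⁄dX ℂ⟦X⟧ w))
        (coeffNorms (l1Norm enorm s) (speedSeries w * xiDeriv w) +
          coeffNorms (l1Norm enorm s) (w * xiDeriv (speedSeries w))) := fun n => by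
      simpa only [hw, coeffNorms, map_add, map_sub, PowerSeries.coeff_mk] using
        l1Norm_enorm_sub_le s _ _
    refine ((MajorizedBy.refl _).mul hsub).trans ?_
    rw [mul_add]
    exact (coeffNorms_mul_xiDeriv s δ _ w).add (coeffNorms_mul_xiDeriv s δ w _)
  rw [mul_add, hf]
  refine ((coeffNorms_mul_xiDeriv s δ _ f).add hw').trans
    (((hV.mul hF).add ((hV.mul hW).add (hW.mul hV))).trans fun n => le_of_eq ?_)
  congr 1
  rw [show (6 * R : ℝ≥0∞) = 2 * R + (2 * R + 2 * R) by ring, map_add, map_add]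
  ring

theorem exists_l1Norm_formal_solution_ne_top {f w : ℂ⟦X⟧⟦X⟧} {s R : ℝ≥0} (hs : 1 ≤ s) (hsR : s < R)
    (hf : d⁄dX ℂ⟦X⟧ f = speedSeries w * xiDeriv f)
    (hw : d⁄dX ℂ⟦X⟧ w = speedSeries w * xiDeriv w - w * xiDeriv (speedSeries w))
    (hf₀ : l1Norm enorm R (PowerSeries.coeff 0 f) ≠ ∞)
    (hw₀ : l1Norm enorm R (PowerSeries.coeff 0 w) ≠ ∞) :
    ∃ τ : ℝ≥0, 0 < τ ∧ l1Norm (l1Norm enorm s) τ f ≠ ∞ ∧ l1Norm (l1Norm enorm s) τ w ≠ ∞ := by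
  let b : ℝ≥0 → ℝ≥0∞⟦X⟧ := fun s =>
    coeffNorms (l1Norm enorm s) f + coeffNorms (l1Norm enorm s) w
  obtain ⟨C, hC⟩ : ∃ C : ℝ≥0, (C : ℝ≥0∞) =
      l1Norm enorm R (PowerSeries.coeff 0 f) + l1Norm enorm R (PowerSeries.coeff 0 w) :=
    ⟨_, ENNReal.coe_toNNReal (ENNReal.add_ne_top.mpr ⟨hf₀, hw₀⟩)⟩
  obtain ⟨τ, hτ, hb⟩ := exists_l1Norm_le_of_scale (s₀ := 1) (R := R) (K := 6 * R) (M := C + 1)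
    (p := 3) (by simp) (by positivity) b
    (fun σ hσ => by
      simp only [b, map_add, coeffNorms, PowerSeries.coeff_mk]
      refine (add_le_add (l1Norm_mono_radius _ hσ _) (l1Norm_mono_radius _ hσ _)).trans ?_
      rw [← hC]
      exact_mod_cast le_self_add)
    (fun σ δ hσ hδ j => by
      have h := coeffNorms_formal_solution hσ hδ hf hw j
      simp only [PowerSeries.coeff_C_mul, map_add, ← succ_mul_coeff_coeffNorms] at h
      simp only [b, map_add, ENNReal.coe_mul]
      exact le_of_eq_of_le (by ring) h)
  refine ⟨(R - s) * τ, mul_pos (tsub_pos_of_lt hsR) hτ, ?_⟩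
  have hfin : l1Norm id ((R - s) * τ) (b s) ≠ ∞ := ne_top_of_le_ne_top ENNReal.coe_ne_top
    (hb s (R - s) hs (add_tsub_cancel_of_le hsR.le).le)
  rw [← l1Norm_id_coeffNorms (l1Norm enorm s), ← l1Norm_id_coeffNorms (l1Norm enorm s)]
  exact ⟨ne_top_of_le_ne_top hfin ((majorizedBy_add_right _ _).l1Norm_le _),
    ne_top_of_le_ne_top hfin ((majorizedBy_add_left _ _).l1Norm_le _)⟩

end Convergence

section Evaluation

/-- The sum at `z ∈ ℂ` of a power series with complex coefficients; a junk value where the series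
diverges. -/
noncomputable def seriesEval (u : ℂ⟦X⟧) (z : ℂ) : ℂ :=
  ∑' n, PowerSeries.coeff n u * z ^ n

variable {u v : ℂ⟦X⟧} {s : ℝ≥0} {z : ℂ}

theorem tsum_enorm_coeff_mul_pow_le (u : ℂ⟦X⟧) (hz : ‖z‖₊ ≤ s) :
    ∑' n, ‖PowerSeries.coeff n u * z ^ n‖ₑ ≤ l1Norm enorm s u :=
  ENNReal.tsum_le_tsum fun n => by
    rw [enorm_mul, enorm_pow]
    gcongr
    exact ENNReal.coe_le_coe.mpr hz

theorem summable_norm_coeff_mul_pow (hu : l1Norm enorm s u ≠ ∞) (hz : ‖z‖₊ ≤ s) :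
    Summable fun n => ‖PowerSeries.coeff n u * z ^ n‖ :=
  (tsum_enorm_ne_top_iff_summable_norm).mp
    (ne_top_of_le_ne_top hu (tsum_enorm_coeff_mul_pow_le u hz))

theorem enorm_seriesEval_le (u : ℂ⟦X⟧) (hz : ‖z‖₊ ≤ s) :
    ‖seriesEval u z‖ₑ ≤ l1Norm enorm s u :=
  enorm_tsum_le_tsum_enorm.trans (tsum_enorm_coeff_mul_pow_le u hz)

theorem seriesEval_mul (hu : l1Norm enorm s u ≠ ∞) (hv : l1Norm enorm s v ≠ ∞) (hz : ‖z‖₊ ≤ s) :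
    seriesEval (u * v) z = seriesEval u z * seriesEval v z := by
  rw [seriesEval, seriesEval, seriesEval, tsum_mul_tsum_eq_tsum_sum_antidiagonal_of_summable_norm
    (summable_norm_coeff_mul_pow hu hz) (summable_norm_coeff_mul_pow hv hz)]
  refine tsum_congr fun n => ?_
  rw [PowerSeries.coeff_mul, Finset.sum_mul]
  refine Finset.sum_congr rfl fun p hp => ?_
  rw [← Finset.HasAntidiagonal.mem_antidiagonal.mp hp, pow_add]
  ring

theorem seriesEval_add (hu : l1Norm enorm s u ≠ ∞) (hv : l1Norm enorm s v ≠ ∞) (hz : ‖z‖₊ ≤ s) :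
    seriesEval (u + v) z = seriesEval u z + seriesEval v z := by
  simp only [seriesEval, map_add, add_mul]
  exact (summable_norm_coeff_mul_pow hu hz).of_norm.tsum_add
    (summable_norm_coeff_mul_pow hv hz).of_norm

theorem seriesEval_sum {ι : Type*} (t : Finset ι) {a : ι → ℂ⟦X⟧}
    (ha : ∀ i ∈ t, l1Norm enorm s (a i) ≠ ∞) (hz : ‖z‖₊ ≤ s) :
    seriesEval (∑ i ∈ t, a i) z = ∑ i ∈ t, seriesEval (a i) z := by
  simp only [seriesEval, map_sum, Finset.sum_mul]
  exact Summable.tsum_finsetSum fun i hi => (summable_norm_coeff_mul_pow (ha i hi) hz).of_norm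

theorem seriesEval_mul_C (u : ℂ⟦X⟧) (a z : ℂ) :
    seriesEval (u * PowerSeries.C a) z = seriesEval u z * a := by
  simp only [seriesEval, PowerSeries.coeff_mul_C, ← tsum_mul_right]
  exact tsum_congr fun n => by ring

theorem seriesEval_C (a z : ℂ) : seriesEval (PowerSeries.C a) z = a := by
  rw [seriesEval, tsum_eq_single 0 fun n hn => by simp [PowerSeries.coeff_C, hn]]
  simp

theorem seriesEval_X_mul (u : ℂ⟦X⟧) (z : ℂ) :
    seriesEval (PowerSeries.X * u) z = z * seriesEval u z := by
  rw [seriesEval, ← (add_left_injective 1).tsum_eq fun n hn => ⟨n - 1, Nat.sub_add_cancel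
    (Nat.one_le_iff_ne_zero.mpr fun h => hn (by simp [h]))⟩]
  simp only [seriesEval, PowerSeries.coeff_succ_X_mul, ← tsum_mul_left]
  exact tsum_congr fun n => by ring

theorem seriesEval_zero_right (u : ℂ⟦X⟧) : seriesEval u 0 = PowerSeries.coeff 0 u := by
  rw [seriesEval, tsum_eq_single 0 fun n hn => by simp [hn]]
  simp

theorem conj_seriesEval (u : ℂ⟦X⟧) (z : ℂ) :
    conj (seriesEval u z) = seriesEval (u.map (starRingEnd ℂ)) (conj z) := by
  simp only [seriesEval, Complex.conj_tsum, PowerSeries.coeff_map, map_mul, map_pow]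

theorem hasDerivAt_tsum_of_enorm_le {F F' : ℕ → ℂ → ℂ} {b : ℕ → ℝ≥0∞} (hb : ∑' n, b n ≠ ∞)
    {U : Set ℂ} (hU : IsOpen U) (hF : ∀ n, ∀ z ∈ U, HasDerivAt (F n) (F' n z) z)
    (hle : ∀ n, ∀ z ∈ U, ‖F n z‖ₑ ≤ b n) (hz : z ∈ U) :
    HasDerivAt (fun z => ∑' n, F n z) (∑' n, F' n z) z := by
  have hdiff : ∀ n, DifferentiableOn ℂ (F n) U := fun n z hz =>
    (hF n z hz).differentiableAt.differentiableWithinAt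
  have hbound : ∀ n, ∀ z ∈ U, ‖F n z‖ ≤ (b n).toReal := fun n z hz => by
    simpa only [toReal_enorm] using
      ENNReal.toReal_mono (ENNReal.ne_top_of_tsum_ne_top hb n) (hle n z hz)
  have hsum := ENNReal.summable_toReal hb
  have hderiv := Complex.hasSum_deriv_of_summable_norm hsum hdiff hU hbound hz
  rw [tsum_congr fun n => (hF n z hz).deriv.symm, hderiv.tsum_eq]
  exact ((Complex.differentiableOn_tsum_of_summable_norm hsum hdiff hU hbound).differentiableAt
    (hU.mem_nhds hz)).hasDerivAt

theorem hasDerivAt_seriesEval (hu : l1Norm enorm s u ≠ ∞) (hz : ‖z‖₊ < s) :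
    HasDerivAt (seriesEval u) (seriesEval (d⁄dX ℂ u) z) z := by
  have hzU : z ∈ {z : ℂ | ‖z‖₊ < s} := hz
  have hmain := hasDerivAt_tsum_of_enorm_le (F := fun n z => PowerSeries.coeff n u * z ^ n)
    (F' := fun n z => PowerSeries.coeff n u * (n * z ^ (n - 1))) hu
    (isOpen_lt continuous_nnnorm continuous_const)
    (fun n z _ => (hasDerivAt_pow n z).const_mul _)
    (fun n z hz => by
      rw [enorm_mul, enorm_pow]
      gcongr
      exact ENNReal.coe_le_coe.mpr (le_of_lt hz)) hzU
  have hderiv : seriesEval (d⁄dX ℂ u) z =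
      ∑' n, PowerSeries.coeff n u * (n * z ^ (n - 1)) := by
    rw [← (add_left_injective 1).tsum_eq fun n hn => ⟨n - 1, Nat.sub_add_cancel
      (Nat.one_le_iff_ne_zero.mpr fun h => hn (by simp [h]))⟩]
    simp only [seriesEval, PowerSeries.coeff_derivative, Nat.add_sub_cancel, Nat.cast_succ,
      mul_assoc]
  exact hderiv ▸ hmain

/-- The power series in the time variable obtained by evaluating the coefficients of a power series
over `ℂ⟦ξ⟧` at the point `ξ`. -/
noncomputable def xiEval (ξ : ℂ) (x : ℂ⟦X⟧⟦X⟧) : ℂ⟦X⟧ :=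
  PowerSeries.mk fun n => seriesEval (PowerSeries.coeff n x) ξ

/-- The sum at `(ξ, t)` of a power series in the time variable over `ℂ⟦ξ⟧`. -/
noncomputable def jointEval (x : ℂ⟦X⟧⟦X⟧) (ξ t : ℂ) : ℂ :=
  seriesEval (xiEval ξ x) t

variable {x y : ℂ⟦X⟧⟦X⟧} {τ : ℝ≥0} {ξ t : ℂ}

theorem coeff_xiEval (ξ : ℂ) (x : ℂ⟦X⟧⟦X⟧) (n : ℕ) :
    PowerSeries.coeff n (xiEval ξ x) = seriesEval (PowerSeries.coeff n x) ξ :=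
  PowerSeries.coeff_mk n fun n => seriesEval (PowerSeries.coeff n x) ξ

theorem l1Norm_xiEval_le (x : ℂ⟦X⟧⟦X⟧) (hξ : ‖ξ‖₊ ≤ s) :
    l1Norm enorm τ (xiEval ξ x) ≤ l1Norm (l1Norm enorm s) τ x :=
  ENNReal.tsum_le_tsum fun n => by
    rw [coeff_xiEval]
    gcongr
    exact enorm_seriesEval_le _ hξ

theorem l1Norm_coeff_ne_top {A : Type*} [Semiring A] {N : A → ℝ≥0∞} {u : A⟦X⟧} (hτ : 0 < τ)
    (hu : l1Norm N τ u ≠ ∞) (n : ℕ) : N (PowerSeries.coeff n u) ≠ ∞ :=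
  (ENNReal.lt_top_of_mul_ne_top_left (ENNReal.ne_top_of_tsum_ne_top hu n)
    (pow_ne_zero n (ENNReal.coe_ne_zero.mpr hτ.ne'))).ne

theorem xiEval_mul (hx : ∀ n, l1Norm enorm s (PowerSeries.coeff n x) ≠ ∞)
    (hy : ∀ n, l1Norm enorm s (PowerSeries.coeff n y) ≠ ∞) (hξ : ‖ξ‖₊ ≤ s) :
    xiEval ξ (x * y) = xiEval ξ x * xiEval ξ y := PowerSeries.ext fun n => by
  simp only [coeff_xiEval, PowerSeries.coeff_mul]
  have hmul : ∀ p : ℕ × ℕ,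
      l1Norm enorm s (PowerSeries.coeff p.1 x * PowerSeries.coeff p.2 y) ≠ ∞ := fun p =>
    ne_top_of_le_ne_top (ENNReal.mul_ne_top (hx p.1) (hy p.2))
      ((isSubmulSeminorm_l1Norm_enorm s).map_mul_le _ _)
  rw [seriesEval_sum _ (fun p _ => hmul p) hξ]
  exact Finset.sum_congr rfl fun p _ => seriesEval_mul (hx p.1) (hy p.2) hξ

theorem jointEval_mul (hτ : 0 < τ) (hx : l1Norm (l1Norm enorm s) τ x ≠ ∞)
    (hy : l1Norm (l1Norm enorm s) τ y ≠ ∞) (hξ : ‖ξ‖₊ ≤ s) (ht : ‖t‖₊ ≤ τ) :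
    jointEval (x * y) ξ t = jointEval x ξ t * jointEval y ξ t := by
  rw [jointEval, xiEval_mul (l1Norm_coeff_ne_top hτ hx) (l1Norm_coeff_ne_top hτ hy) hξ]
  exact seriesEval_mul (ne_top_of_le_ne_top hx (l1Norm_xiEval_le x hξ))
    (ne_top_of_le_ne_top hy (l1Norm_xiEval_le y hξ)) ht

theorem xiEval_C (ξ : ℂ) (u : ℂ⟦X⟧) :
    xiEval ξ (PowerSeries.C u) = PowerSeries.C (seriesEval u ξ) := PowerSeries.ext fun n => by
  rw [coeff_xiEval, PowerSeries.coeff_C, PowerSeries.coeff_C]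
  split_ifs
  · rfl
  · simp [seriesEval]

theorem jointEval_C (u : ℂ⟦X⟧) (ξ t : ℂ) : jointEval (PowerSeries.C u) ξ t = seriesEval u ξ := by
  rw [jointEval, xiEval_C, seriesEval_C]

theorem jointEval_C_X_mul (x : ℂ⟦X⟧⟦X⟧) (ξ t : ℂ) :
    jointEval (PowerSeries.C PowerSeries.X * x) ξ t = ξ * jointEval x ξ t := by
  rw [jointEval, jointEval, seriesEval, seriesEval, ← tsum_mul_left]
  refine tsum_congr fun n => ?_
  rw [coeff_xiEval, coeff_xiEval, PowerSeries.coeff_C_mul, seriesEval_X_mul, mul_assoc]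

theorem xiEval_zero_left (x : ℂ⟦X⟧⟦X⟧) : xiEval 0 x = x.map PowerSeries.constantCoeff :=
  PowerSeries.ext fun n => by
    rw [coeff_xiEval, seriesEval_zero_right, PowerSeries.coeff_map,
      PowerSeries.coeff_zero_eq_constantCoeff_apply]

theorem jointEval_zero_time (x : ℂ⟦X⟧⟦X⟧) (ξ : ℂ) :
    jointEval x ξ 0 = seriesEval (PowerSeries.coeff 0 x) ξ := by
  rw [jointEval, seriesEval_zero_right, coeff_xiEval]

theorem xiEval_derivative (ξ : ℂ) (x : ℂ⟦X⟧⟦X⟧) :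
    xiEval ξ (d⁄dX ℂ⟦X⟧ x) = d⁄dX ℂ (xiEval ξ x) := PowerSeries.ext fun n => by
  have hcast : (n + 1 : ℂ⟦X⟧) = PowerSeries.C (n + 1 : ℂ) := by simp
  rw [coeff_xiEval, PowerSeries.coeff_derivative, PowerSeries.coeff_derivative, coeff_xiEval,
    hcast, seriesEval_mul_C]

theorem hasDerivAt_jointEval_time (hx : l1Norm (l1Norm enorm s) τ x ≠ ∞) (hξ : ‖ξ‖₊ ≤ s)
    (ht : ‖t‖₊ < τ) : HasDerivAt (jointEval x ξ) (jointEval (d⁄dX ℂ⟦X⟧ x) ξ t) t := by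
  rw [jointEval, xiEval_derivative]
  exact hasDerivAt_seriesEval (ne_top_of_le_ne_top hx (l1Norm_xiEval_le x hξ)) ht

theorem hasDerivAt_jointEval_xi (hτ : 0 < τ) (hx : l1Norm (l1Norm enorm s) τ x ≠ ∞)
    (hξ : ‖ξ‖₊ < s) (ht : ‖t‖₊ ≤ τ) :
    HasDerivAt (fun ξ => jointEval x ξ t) (jointEval (xiDeriv x) ξ t) ξ := by
  simp only [jointEval, seriesEval, coeff_xiEval, coeff_coeffwiseDerivation]
  refine hasDerivAt_tsum_of_enorm_le hx (U := {ξ : ℂ | ‖ξ‖₊ < s})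
    (isOpen_lt continuous_nnnorm continuous_const)
    (fun n ξ hξ => (hasDerivAt_seriesEval (l1Norm_coeff_ne_top hτ hx n) hξ).mul_const _)
    (fun n ξ hξ => ?_) hξ
  rw [enorm_mul, enorm_pow]
  gcongr
  · exact enorm_seriesEval_le _ (le_of_lt hξ)
  · exact ENNReal.coe_le_coe.mpr ht

theorem l1Norm_xiDeriv_ne_top {s' : ℝ≥0} (h : s < s') (hx : l1Norm (l1Norm enorm s') τ x ≠ ∞) :
    l1Norm (l1Norm enorm s) τ (xiDeriv x) ≠ ∞ := by
  have hle : l1Norm (l1Norm enorm s) τ (xiDeriv x) * (s' - s : ℝ≥0) ≤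
      l1Norm (l1Norm enorm s') τ x := by
    rw [l1Norm, ← ENNReal.tsum_mul_right]
    refine ENNReal.tsum_le_tsum fun n => ?_
    have hn := l1Norm_derivative_mul_le isSubmulSeminorm_enorm s (s' - s) (PowerSeries.coeff n x)
    rw [add_tsub_cancel_of_le h.le] at hn
    rw [coeff_coeffwiseDerivation, mul_right_comm]
    gcongr
  exact (ENNReal.lt_top_of_mul_ne_top_left (ne_top_of_le_ne_top hx hle)
    (ENNReal.coe_ne_zero.mpr (tsub_pos_of_lt h).ne')).ne

theorem enorm_jointEval_le (x : ℂ⟦X⟧⟦X⟧) (hξ : ‖ξ‖₊ ≤ s) (ht : ‖t‖₊ ≤ τ) :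
    ‖jointEval x ξ t‖ₑ ≤ l1Norm (l1Norm enorm s) τ x :=
  (enorm_seriesEval_le _ ht).trans (l1Norm_xiEval_le x hξ)

theorem exists_lipschitz_jointEval {τ' : ℝ≥0} (h : τ < τ')
    (hx : l1Norm (l1Norm enorm s) τ' x ≠ ∞) :
    ∃ L : ℝ, ∀ ξ t t' : ℂ, ‖ξ‖₊ ≤ s → ‖t‖₊ ≤ τ → ‖t'‖₊ ≤ τ →
      ‖jointEval x ξ t' - jointEval x ξ t‖ ≤ L * ‖t' - t‖ := by
  have hderiv := l1Norm_derivative_ne_top (isSubmulSeminorm_l1Norm_enorm s) h hx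
  refine ⟨(l1Norm (l1Norm enorm s) τ (d⁄dX ℂ⟦X⟧ x)).toReal, fun ξ t t' hξ ht ht' => ?_⟩
  refine (convex_closedBall (0 : ℂ) τ).norm_image_sub_le_of_norm_hasDerivWithin_le
    (f' := jointEval (d⁄dX ℂ⟦X⟧ x) ξ) (fun z hz => ?_) (fun z hz => ?_)
    (mem_closedBall_zero_iff.mpr ht) (mem_closedBall_zero_iff.mpr ht')
  · exact (hasDerivAt_jointEval_time hx hξ
      (lt_of_le_of_lt (mem_closedBall_zero_iff.mp hz) h)).hasDerivWithinAt
  · simpa only [toReal_enorm] using ENNReal.toReal_mono hderiv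
      (enorm_jointEval_le _ hξ (mem_closedBall_zero_iff.mp hz))

end Evaluation

section Schwarz

theorem tsum_prod_eq_tsum_diagonals {a : ℕ × ℕ → ℂ} (ha : Summable a) :
    ∑' p, a p = (∑' k, ∑' m, a (m + k, m)) + ∑' k, ∑' m, a (m, m + (k + 1)) := by
  have hlower : Function.Injective fun p : ℕ × ℕ => (p.2 + p.1, p.2) := fun p q h => by
    grind
  have hupper : Function.Injective fun p : ℕ × ℕ => (p.2, p.2 + (p.1 + 1)) := fun p q h => by
    grind
  have hcompl : IsCompl (range fun p : ℕ × ℕ => (p.2 + p.1, p.2))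
      (range fun p : ℕ × ℕ => (p.2, p.2 + (p.1 + 1))) := by
    refine ⟨disjoint_left.mpr ?_, codisjoint_iff_le_sup.mpr ?_⟩
    · rintro _ ⟨p, rfl⟩ ⟨q, hq⟩
      grind
    · rintro ⟨n, m⟩ -
      rcases le_or_gt m n with h | h
      · exact Or.inl ⟨(n - m, m), Prod.ext (Nat.add_sub_of_le h) rfl⟩
      · exact Or.inr ⟨(m - n - 1, n), Prod.ext rfl (by dsimp only; omega)⟩
  have hsum_lower := (hlower.hasSum_range_iff (f := a)).mpr (ha.comp_injective hlower).hasSum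
  have hsum_upper := (hupper.hasSum_range_iff (f := a)).mpr (ha.comp_injective hupper).hasSum
  have hsum := hsum_lower.add_isCompl hcompl hsum_upper
  rw [hsum.tsum_eq, (ha.comp_injective hlower).tsum_prod, (ha.comp_injective hupper).tsum_prod]
  rfl

theorem tsum_ite_one_two_mul {x : ℕ → ℂ} (hx : Summable x) :
    ∑' k, (if k = 0 then 1 else 2) * x k = x 0 + 2 * ∑' k, x (k + 1) := by
  have hsummable : Summable fun k => (if k = 0 then 1 else 2) * x k := by
    rw [← summable_nat_add_iff 1]
    simpa using ((summable_nat_add_iff 1).mpr hx).mul_left 2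
  rw [hsummable.tsum_eq_zero_add]
  simp [tsum_mul_left]

theorem two_mul_tsum_prod {a : ℕ × ℕ → ℂ} (ha : Summable a) :
    2 * ∑' p, a p = (∑' k, (if k = 0 then 1 else 2) * ∑' m, a (m + k, m)) +
      ∑' k, (if k = 0 then 1 else 2) * ∑' m, a (m, m + k) := by
  have hlower : Summable fun k => ∑' m, a (m + k, m) :=
    (ha.comp_injective (i := fun p : ℕ × ℕ => (p.2 + p.1, p.2)) fun p q h => by grind).prod
  have hupper : Summable fun k => ∑' m, a (m, m + k) :=
    (ha.comp_injective (i := fun p : ℕ × ℕ => (p.2, p.2 + p.1)) fun p q h => by grind).prod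
  rw [tsum_prod_eq_tsum_diagonals ha, tsum_ite_one_two_mul hlower, tsum_ite_one_two_mul hupper,
    hlower.tsum_eq_zero_add]
  simp only [add_zero]
  ring

theorem two_mul_seriesEval_mul_conj {s : ℝ≥0} (hs : 1 ≤ s) {u v : ℂ⟦X⟧}
    (hu : l1Norm enorm s u ≠ ∞) (hv : l1Norm enorm s v ≠ ∞) {z : ℂ} (hz : ‖z‖ = 1) :
    2 * (seriesEval u z * conj (seriesEval v z)) =
      seriesEval (schwarzPair u v) z + conj (seriesEval (schwarzPair v u) z) := by
  have hzs : ‖z‖₊ ≤ s := by rwa [show ‖z‖₊ = 1 from NNReal.eq hz]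
  have hpow : ∀ m : ℕ, z ^ m * conj z ^ m = 1 := fun m => by
    rw [← mul_pow, Complex.mul_conj', hz]
    simp
  have hu' := summable_norm_coeff_mul_pow hu hzs
  have hv' : Summable fun n => ‖conj (PowerSeries.coeff n v * z ^ n)‖ := by
    simpa only [RCLike.norm_conj] using summable_norm_coeff_mul_pow hv hzs
  rw [seriesEval, seriesEval, Complex.conj_tsum, tsum_mul_tsum_of_summable_norm hu' hv',
    two_mul_tsum_prod (summable_mul_of_summable_norm hu' hv'), seriesEval, seriesEval,
    Complex.conj_tsum]
  congr 1 <;> refine tsum_congr fun k => ?_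
  · rw [schwarzPair, PowerSeries.coeff_mk, mul_assoc, ← tsum_mul_right]
    refine congrArg _ (tsum_congr fun m => ?_)
    simp only [map_mul, map_pow, pow_add]
    linear_combination
      (PowerSeries.coeff (m + k) u * conj (PowerSeries.coeff m v) * z ^ k) * hpow m
  · have hweight : conj (if k = 0 then 1 else 2 : ℂ) = if k = 0 then 1 else 2 := by
      split_ifs
      exacts [map_one _, Complex.conj_ofNat 2]
    rw [schwarzPair, PowerSeries.coeff_mk, mul_assoc, ← tsum_mul_right, map_mul, hweight,
      Complex.conj_tsum]
    refine congrArg _ (tsum_congr fun m => ?_)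
    simp only [map_mul, map_pow, Complex.conj_conj, pow_add]
    linear_combination
      (PowerSeries.coeff m u * conj (PowerSeries.coeff (m + k) v) * conj z ^ k) * hpow m

theorem conj_coeff_zero_schwarzPair (u v : ℂ⟦X⟧) :
    conj (PowerSeries.coeff 0 (schwarzPair u v)) = PowerSeries.coeff 0 (schwarzPair v u) := by
  simp [schwarzPair, Complex.conj_tsum, mul_comm]

theorem map_conj_xiEval_schwarzSeries_zero (w : ℂ⟦X⟧⟦X⟧) :
    (xiEval 0 (schwarzSeries w)).map (starRingEnd ℂ) = xiEval 0 (schwarzSeries w) :=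
  PowerSeries.ext fun n => by
    simp only [PowerSeries.coeff_map, coeff_xiEval, seriesEval_zero_right, schwarzSeries,
      PowerSeries.coeff_mk, map_sum, conj_coeff_zero_schwarzPair]
    exact Finset.Nat.sum_antidiagonal_swap (f := fun p =>
      PowerSeries.coeff 0 (schwarzPair (PowerSeries.coeff p.1 w) (PowerSeries.coeff p.2 w)))

variable {s τ : ℝ≥0} {w : ℂ⟦X⟧⟦X⟧} {z t : ℂ}

theorem l1Norm_schwarzPair_ne_top {u v : ℂ⟦X⟧} (hs : 1 ≤ s) (hu : l1Norm enorm s u ≠ ∞)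
    (hv : l1Norm enorm s v ≠ ∞) : l1Norm enorm s (schwarzPair u v) ≠ ∞ :=
  ne_top_of_le_ne_top (ENNReal.mul_ne_top (by simp) (ENNReal.mul_ne_top hu hv))
    (l1Norm_schwarzPair_le hs u v)

theorem two_mul_xiEval_mul_map_conj (hs : 1 ≤ s)
    (hw : ∀ n, l1Norm enorm s (PowerSeries.coeff n w) ≠ ∞) (hz : ‖z‖ = 1) :
    2 * (xiEval z w * (xiEval z w).map (starRingEnd ℂ)) =
      xiEval z (schwarzSeries w) + (xiEval z (schwarzSeries w)).map (starRingEnd ℂ) := by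
  have hzs : ‖z‖₊ ≤ s := by rwa [show ‖z‖₊ = 1 from NNReal.eq hz]
  refine PowerSeries.ext fun n => ?_
  have hcoeff : seriesEval (PowerSeries.coeff n (schwarzSeries w)) z =
      ∑ p ∈ Finset.HasAntidiagonal.antidiagonal n,
        seriesEval (schwarzPair (PowerSeries.coeff p.1 w) (PowerSeries.coeff p.2 w)) z := by
    rw [schwarzSeries, PowerSeries.coeff_mk]
    exact seriesEval_sum _ (fun p _ => l1Norm_schwarzPair_ne_top hs (hw p.1) (hw p.2)) hzs
  rw [two_mul, map_add, map_add, PowerSeries.coeff_map, coeff_xiEval, hcoeff, map_sum,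
    ← Finset.Nat.sum_antidiagonal_swap (f := fun p => conj (seriesEval _ z)),
    ← Finset.sum_add_distrib, ← two_mul, PowerSeries.coeff_mul, Finset.mul_sum]
  refine Finset.sum_congr rfl fun p _ => ?_
  rw [PowerSeries.coeff_map, coeff_xiEval, coeff_xiEval,
    two_mul_seriesEval_mul_conj hs (hw p.1) (hw p.2) hz]
  rfl

theorem re_jointEval_schwarzSeries {t : ℝ} (hs : 1 ≤ s) (hτ : 0 < τ)
    (hw : l1Norm (l1Norm enorm s) τ w ≠ ∞) (hz : ‖z‖ = 1) (ht : ‖(t : ℂ)‖₊ ≤ τ) :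
    (jointEval (schwarzSeries w) z t).re = ‖jointEval w z t‖ ^ 2 := by
  have hzs : ‖z‖₊ ≤ s := by rwa [show ‖z‖₊ = 1 from NNReal.eq hz]
  have hconj : ∀ u : ℂ⟦X⟧, seriesEval (u.map (starRingEnd ℂ)) t = conj (seriesEval u t) :=
    fun u => by rw [conj_seriesEval, Complex.conj_ofReal]
  have hmap : ∀ u : ℂ⟦X⟧, l1Norm enorm τ (u.map (starRingEnd ℂ)) = l1Norm enorm τ u := fun u =>
    tsum_congr fun n => by rw [PowerSeries.coeff_map, RCLike.enorm_conj]
  have hwz := ne_top_of_le_ne_top hw (l1Norm_xiEval_le w hzs)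
  have hSz := ne_top_of_le_ne_top (l1Norm_schwarzSeries_ne_top hs hw)
    (l1Norm_xiEval_le (schwarzSeries w) hzs)
  have htwo : (2 : ℂ⟦X⟧) = PowerSeries.C 2 := rfl
  have heval := two_mul_xiEval_mul_map_conj hs (l1Norm_coeff_ne_top hτ hw) hz
  rw [mul_comm, htwo] at heval
  replace heval := congrArg (seriesEval · (t : ℂ)) heval
  rw [seriesEval_mul_C, seriesEval_mul hwz ((hmap _).trans_ne hwz) ht,
    seriesEval_add hSz ((hmap _).trans_ne hSz) ht, hconj, hconj] at heval
  rw [Complex.mul_conj', Complex.add_conj] at heval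
  have hreal : ‖jointEval w z t‖ ^ 2 * 2 = 2 * (jointEval (schwarzSeries w) z t).re := by
    exact_mod_cast heval
  linarith

theorem schwarzP_eq_circleAverage (g : ℂ → ℂ) (ξ : ℂ) :
    schwarzP g ξ =
      Real.circleAverage (fun z => herglotzRieszKernel 0 ξ z • g z) 0 1 := by
  rw [Real.circleAverage_eq_circleIntegral one_ne_zero, schwarzP, smul_eq_mul]
  simp only [herglotzRieszKernel_def, sub_zero, smul_eq_mul, div_eq_inv_mul, mul_comm]

theorem schwarzP_congr {g h : ℂ → ℂ} (hgh : EqOn g h (Metric.sphere 0 1)) (ξ : ℂ) :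
    schwarzP g ξ = schwarzP h ξ := by
  rw [schwarzP_eq_circleAverage, schwarzP_eq_circleAverage]
  refine Real.circleAverage_congr_sphere fun z hz => ?_
  simp only [hgh (by simpa using hz)]

theorem re_schwarzP_ofReal_re {g : ℂ → ℂ} (hg : DiffContOnCl ℂ g (Metric.ball 0 1)) {ξ : ℂ}
    (hξ : ξ ∈ Metric.ball (0 : ℂ) 1) : (schwarzP (fun z => ((g z).re : ℂ)) ξ).re = (g ξ).re := by
  have hgc : ContinuousOn g (Metric.sphere 0 |1|) :=
    hg.continuousOn_ball.mono (by simpa using Metric.sphere_subset_closedBall)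
  have hkernel_integrable : CircleIntegrable ((Complex.re ∘ herglotzRieszKernel 0 ξ) • g) 0 1 := by
    refine ContinuousOn.circleIntegrable' (ContinuousOn.smul ?_ hgc)
    exact Complex.continuous_re.comp_continuousOn
      (continuousOn_herglotzRieszKernel_sphere hξ)
  have hgre : CircleIntegrable (fun z => (g z).re) 0 1 :=
    (Complex.continuous_re.comp_continuousOn hgc).circleIntegrable'
  rw [schwarzP_eq_circleAverage, re_circleAverage_herglotzRieszKernel_smul hgre hξ,
    ← hg.circleAverage_re_herglotzRieszKernel_smul hξ, ← Complex.reCLM_apply,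
    ← Complex.reCLM.circleAverage_comp_comm hkernel_integrable]
  congr 1
  ext z
  simp

theorem im_schwarzP_ofReal_zero {g : ℂ → ℝ} (hg : ContinuousOn g (Metric.sphere 0 1)) :
    (schwarzP (fun z => (g z : ℂ)) 0).im = 0 := by
  have hkernel : EqOn (fun z => herglotzRieszKernel 0 0 z • (g z : ℂ))
      (Complex.ofRealCLM ∘ g) (Metric.sphere 0 |1|) := fun z hz => by
    have hz0 : z ≠ 0 := fun h => by simp [h] at hz
    simp [herglotzRieszKernel_def, hz0]
  rw [schwarzP_eq_circleAverage, Real.circleAverage_congr_sphere hkernel,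
    Complex.ofRealCLM.circleAverage_comp_comm
      (ContinuousOn.circleIntegrable' (by simpa using hg))]
  exact Complex.ofReal_im _

theorem schwarzP_ofReal_re {g : ℂ → ℂ} (hg : DiffContOnCl ℂ g (Metric.ball 0 1))
    (hg0 : (g 0).im = 0) {ξ : ℂ} (hξ : ξ ∈ Metric.ball (0 : ℂ) 1) :
    schwarzP (fun z => ((g z).re : ℂ)) ξ = g ξ := by
  have hgc : ContinuousOn (fun z => (g z).re) (Metric.sphere 0 1) :=
    Complex.continuous_re.comp_continuousOn
      (hg.continuousOn_ball.mono Metric.sphere_subset_closedBall)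
  have hanalytic : AnalyticOnNhd ℂ (schwarzP fun z => ((g z).re : ℂ)) (Metric.ball 0 1) := by
    rw [funext (schwarzP_eq_circleAverage _)]
    exact analyticOnNhd_circleAverage_herglotzRieszKernel_smul
      ((Complex.continuous_ofReal.comp_continuousOn hgc).circleIntegrable zero_le_one)
  obtain ⟨c, hc⟩ := (hanalytic.sub (hg.differentiableOn.analyticOnNhd
    Metric.isOpen_ball)).eq_const_of_re_eq_const (c₀ := 0)
    (fun z hz => by simp [re_schwarzP_ofReal_re hg hz]) Metric.isOpen_ball
    (Metric.isConnected_ball zero_lt_one)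
  have hzero : (0 : ℂ) ∈ Metric.ball (0 : ℂ) 1 := Metric.mem_ball_self one_pos
  have hc0 : c = 0 := by
    rw [← hc 0 hzero]
    exact Complex.ext (by simp [re_schwarzP_ofReal_re hg hzero])
      (by simp [im_schwarzP_ofReal_zero hgc, hg0])
  exact sub_eq_zero.mp ((hc ξ hξ).trans hc0)

theorem schwarzP_norm_jointEval_sq {t : ℝ} (hs : 1 < s) (hτ : 0 < τ)
    (hw : l1Norm (l1Norm enorm s) τ w ≠ ∞) (ht : ‖(t : ℂ)‖₊ ≤ τ) {ξ : ℂ}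
    (hξ : ξ ∈ Metric.ball (0 : ℂ) 1) :
    schwarzP (fun z => ((‖jointEval w z t‖ ^ 2 : ℝ) : ℂ)) ξ =
      jointEval (schwarzSeries w) ξ t := by
  have hS := l1Norm_schwarzSeries_ne_top hs.le hw
  have hdiff : DifferentiableOn ℂ (fun z => jointEval (schwarzSeries w) z t)
      (Metric.closedBall 0 1) := fun z hz =>
    (hasDerivAt_jointEval_xi hτ hS ((mem_closedBall_zero_iff.mp hz).trans_lt hs)
      ht).differentiableAt.differentiableWithinAt
  have him : (jointEval (schwarzSeries w) 0 t).im = 0 := by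
    rw [← Complex.conj_eq_iff_im, jointEval, conj_seriesEval, map_conj_xiEval_schwarzSeries_zero,
      Complex.conj_ofReal]
  rw [← schwarzP_ofReal_re (hdiff.diffContOnCl_ball subset_rfl) him hξ]
  refine schwarzP_congr (fun z hz => ?_) ξ
  simp only [re_jointEval_schwarzSeries hs.le hτ hw (by simpa using hz) ht]

end Schwarz

section LocalUnivalence

variable {f : ℂ → ℂ} {z : ℂ}

theorem exists_injOn_of_deriv_ne_zero (hf : AnalyticAt ℂ f z) (hd : deriv f z ≠ 0) :
    ∃ U ∈ 𝓝 z, InjOn f U := by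
  have hstrict := hf.hasStrictDerivAt.hasStrictFDerivAt_equiv hd
  exact ⟨_, (hstrict.toOpenPartialHomeomorph f).open_source.mem_nhds
    hstrict.mem_toOpenPartialHomeomorph_source, (hstrict.toOpenPartialHomeomorph f).injOn⟩

theorem not_eventually_eq_of_injOn {U : Set ℂ} (hU : U ∈ 𝓝 z) (hinj : InjOn f U) :
    ¬∀ᶠ w in 𝓝 z, f w = f z := fun hconst => by
  obtain ⟨w, ⟨hw, hwU⟩, hne⟩ :=
    (((hconst.and hU).filter_mono nhdsWithin_le_nhds).and
      (self_mem_nhdsWithin : {z}ᶜ ∈ 𝓝[≠] z)).exists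
  exact hne (hinj hwU (mem_of_mem_nhds hU) hw)

theorem map_nhds_eq_of_analyticAt_of_injOn {U : Set ℂ} (hf : AnalyticAt ℂ f z) (hU : U ∈ 𝓝 z)
    (hinj : InjOn f U) : map f (𝓝 z) = 𝓝 (f z) :=
  le_antisymm hf.continuousAt
    (hf.eventually_constant_or_nhds_le_map_nhds.resolve_left (not_eventually_eq_of_injOn hU hinj))

theorem eventually_deriv_ne_zero_of_injOn {U : Set ℂ} (hf : AnalyticAt ℂ f z) (hU : U ∈ 𝓝 z)
    (hinj : InjOn f U) : ∀ᶠ w in 𝓝[≠] z, deriv f w ≠ 0 := by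
  refine hf.deriv.eventually_eq_zero_or_eventually_ne_zero.resolve_left fun hzero => ?_
  obtain ⟨ε, hε, hball⟩ := Metric.eventually_nhds_iff_ball.mp (hzero.and hf.eventually_analyticAt)
  refine not_eventually_eq_of_injOn hU hinj
    (eventually_of_mem (Metric.ball_mem_nhds z hε) fun w hw => ?_)
  exact Metric.isOpen_ball.is_const_of_deriv_eq_zero (convex_ball z ε).isPreconnected
    (fun w hw => (hball w hw).2.differentiableAt.differentiableWithinAt)
    (fun w hw => (hball w hw).1) hw (Metric.mem_ball_self hε)

/-- The local inverse is continuous by the open mapping theorem, differentiable away from `f z`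
because the zeros of `f'` are isolated, hence differentiable at `f z` by removal of singularities;
so `f' z` is invertible. -/
theorem deriv_ne_zero_of_injOn {U : Set ℂ} (hf : AnalyticAt ℂ f z) (hU : U ∈ 𝓝 z)
    (hinj : InjOn f U) : deriv f z ≠ 0 := by
  obtain ⟨V, hV, hVopen, hzV⟩ :=
    mem_nhds_iff.mp (inter_mem hU hf.eventually_analyticAt)
  have hinjV : InjOn f V := hinj.mono fun w hw => (hV hw).1
  have hmap : ∀ w ∈ V, map f (𝓝 w) = 𝓝 (f w) := fun w hw =>
    map_nhds_eq_of_analyticAt_of_injOn (hV hw).2 (hVopen.mem_nhds hw) hinjV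
  let g := Function.invFunOn f V
  have hgf : ∀ w ∈ V, g (f w) = w := fun w hw => hinjV.leftInvOn_invFunOn hw
  have hgcont : ∀ w ∈ V, ContinuousAt g (f w) := fun w hw => by
    rw [ContinuousAt, hgf w hw, ← hmap w hw, tendsto_map'_iff]
    exact tendsto_id.congr' (eventually_of_mem (hVopen.mem_nhds hw) fun w hw => (hgf w hw).symm)
  have hgdiff : ∀ w ∈ V, deriv f w ≠ 0 → DifferentiableAt ℂ g (f w) := fun w hw hd => by
    have hderiv : HasDerivAt f (deriv f w) (g (f w)) := by
      rw [hgf w hw]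
      exact (hV hw).2.differentiableAt.hasDerivAt
    refine (hderiv.of_local_left_inverse (hgcont w hw) hd ?_).differentiableAt
    rw [← hmap w hw, eventually_map]
    exact eventually_of_mem (hVopen.mem_nhds hw) fun w hw => congrArg f (hgf w hw)
  have hpunctured : ∀ᶠ y in 𝓝[≠] (f z), DifferentiableAt ℂ g y := by
    rw [eventually_nhdsWithin_iff, ← hmap z hzV, eventually_map]
    filter_upwards [eventually_nhdsWithin_iff.mp (eventually_deriv_ne_zero_of_injOn hf hU hinj),
      hVopen.mem_nhds hzV] with w hd hw hne
    exact hgdiff w hw (hd fun h => hne (congrArg f h))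
  have hg := Complex.analyticAt_of_differentiable_on_punctured_nhds_of_continuousAt hpunctured
    (hgcont z hzV)
  have hcomp : HasDerivAt (g ∘ f) (deriv g (f z) * deriv f z) z :=
    hg.differentiableAt.hasDerivAt.comp z hf.differentiableAt.hasDerivAt
  have hone := hcomp.unique ((hasDerivAt_id z).congr_of_eventuallyEq
    (eventually_of_mem (hVopen.mem_nhds hzV) hgf))
  exact right_ne_zero_of_mul_eq_one hone

end LocalUnivalence

section InitialData

open scoped Nat

/-- The Taylor series of `f` at `0`. -/
noncomputable def taylorSeries (f : ℂ → ℂ) : ℂ⟦X⟧ :=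
  PowerSeries.mk fun n => (n ! : ℂ)⁻¹ * iteratedDeriv n f 0

variable {f g : ℂ → ℂ}

theorem coeff_taylorSeries (f : ℂ → ℂ) (n : ℕ) :
    PowerSeries.coeff n (taylorSeries f) = (n ! : ℂ)⁻¹ * iteratedDeriv n f 0 :=
  PowerSeries.coeff_mk n fun n => (n ! : ℂ)⁻¹ * iteratedDeriv n f 0

theorem coeff_zero_taylorSeries (f : ℂ → ℂ) : PowerSeries.coeff 0 (taylorSeries f) = f 0 := by
  simp [coeff_taylorSeries]

theorem derivative_taylorSeries (f : ℂ → ℂ) :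
    d⁄dX ℂ (taylorSeries f) = taylorSeries (deriv f) := PowerSeries.ext fun n => by
  have hfac : (n ! : ℂ) ≠ 0 := Nat.cast_ne_zero.mpr n.factorial_ne_zero
  have hsucc : (n + 1 : ℂ) ≠ 0 := n.cast_add_one_ne_zero
  rw [PowerSeries.coeff_derivative, coeff_taylorSeries, coeff_taylorSeries, iteratedDeriv_succ',
    Nat.factorial_succ]
  push_cast
  field_simp

theorem taylorSeries_mul (hf : AnalyticAt ℂ f 0) (hg : AnalyticAt ℂ g 0) :
    taylorSeries (f * g) = taylorSeries f * taylorSeries g := PowerSeries.ext fun n => by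
  rw [coeff_taylorSeries, iteratedDeriv_mul hf.contDiffAt hg.contDiffAt, PowerSeries.coeff_mul,
    Finset.Nat.sum_antidiagonal_eq_sum_range_succ fun i j =>
      PowerSeries.coeff i (taylorSeries f) * PowerSeries.coeff j (taylorSeries g), Finset.mul_sum]
  refine Finset.sum_congr rfl fun i hi => ?_
  have hfac : ∀ m : ℕ, (m ! : ℂ) ≠ 0 := fun m => Nat.cast_ne_zero.mpr m.factorial_ne_zero
  have hn := hfac n
  have hi' := hfac i
  have hni := hfac (n - i)
  rw [coeff_taylorSeries, coeff_taylorSeries, Nat.cast_choose ℂ (Finset.mem_range_succ_iff.mp hi)]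
  field_simp

theorem taylorSeries_eq_one (h : f =ᶠ[𝓝 0] 1) : taylorSeries f = 1 := PowerSeries.ext fun n => by
  have hconst : (1 : ℂ → ℂ) = fun _ => 1 := rfl
  rw [coeff_taylorSeries, h.iteratedDeriv_eq n, hconst, iteratedDeriv_const, PowerSeries.coeff_one]
  split_ifs with hn <;> simp [hn]

theorem derivative_taylorSeries_mul_taylorSeries_inv (hf : AnalyticAt ℂ f 0)
    (hd : deriv f 0 ≠ 0) : d⁄dX ℂ (taylorSeries f) * taylorSeries (deriv f)⁻¹ = 1 := by
  rw [derivative_taylorSeries, ← taylorSeries_mul hf.deriv (hf.deriv.inv hd)]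
  refine taylorSeries_eq_one ?_
  filter_upwards [hf.deriv.continuousAt.eventually_ne hd] with z hz using mul_inv_cancel₀ hz

variable {R : ℝ}

theorem seriesEval_taylorSeries (hf : DifferentiableOn ℂ f (Metric.ball 0 R)) :
    EqOn (seriesEval (taylorSeries f)) f (Metric.ball 0 R) := fun z hz => by
  simpa only [seriesEval, coeff_taylorSeries, sub_zero] using Complex.taylorSeries_eq_on_ball' hz hf

theorem l1Norm_taylorSeries_ne_top (hf : DifferentiableOn ℂ f (Metric.ball 0 R)) {s : ℝ≥0}
    (hs : s < R) : l1Norm enorm s (taylorSeries f) ≠ ∞ := by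
  have hsum := (Complex.hasSum_taylorSeries_on_ball hf (z := ((s : ℝ) : ℂ))
    (by simpa using hs)).summable.norm
  convert tsum_enorm_ne_top_iff_summable_norm.mpr hsum using 1
  have hnorm : ‖((s : ℝ) : ℂ)‖ₑ = s := by
    rw [enorm_eq_nnnorm, Complex.nnnorm_real, NNReal.nnnorm_eq]
  refine tsum_congr fun n => ?_
  simp only [coeff_taylorSeries, sub_zero, smul_eq_mul, enorm_mul, enorm_pow, hnorm]
  ring

theorem exists_closedBall_subset_of_isOpen {r : ℝ≥0} {U : Set ℂ} (hU : IsOpen U)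
    (h : Metric.closedBall 0 r ⊆ U) : ∃ R > r, Metric.closedBall (0 : ℂ) R ⊆ U := by
  obtain ⟨δ, hδ, hthick⟩ := (isCompact_closedBall (0 : ℂ) r).exists_cthickening_subset_open hU h
  lift δ to ℝ≥0 using hδ.le
  rw [cthickening_closedBall δ.coe_nonneg r.coe_nonneg] at hthick
  exact ⟨δ + r, lt_add_of_pos_left r (NNReal.coe_pos.mp hδ), by rwa [NNReal.coe_add]⟩

theorem exists_l1Norm_taylorSeries_ne_top {r : ℝ≥0}
    (hf : AnalyticOnNhd ℂ f (Metric.closedBall 0 r))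
    (hinj : LocallyUnivalentOn f (Metric.closedBall 0 r)) :
    ∃ R > r, l1Norm enorm R (taylorSeries f) ≠ ∞ ∧
      l1Norm enorm R (taylorSeries (deriv f)⁻¹) ≠ ∞ ∧
      EqOn (seriesEval (taylorSeries f)) f (Metric.ball 0 R) := by
  have hopen : IsOpen {z | AnalyticAt ℂ f z ∧ deriv f z ≠ 0} := isOpen_iff_mem_nhds.mpr fun z hz =>
    hz.1.eventually_analyticAt.and (hz.1.deriv.continuousAt.eventually_ne hz.2)
  obtain ⟨ρ, hrρ, hρ⟩ := exists_closedBall_subset_of_isOpen hopen fun z hz => by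
    obtain ⟨U, hU, hinjU⟩ := hinj z hz
    exact ⟨hf z hz, deriv_ne_zero_of_injOn (hf z hz) hU hinjU⟩
  have hρ' : ∀ z ∈ Metric.ball (0 : ℂ) ρ, AnalyticAt ℂ f z ∧ deriv f z ≠ 0 := fun z hz =>
    hρ (Metric.ball_subset_closedBall hz)
  have hdiff : DifferentiableOn ℂ f (Metric.ball 0 ρ) := fun z hz =>
    (hρ' z hz).1.differentiableAt.differentiableWithinAt
  have hdiff' : DifferentiableOn ℂ (deriv f)⁻¹ (Metric.ball 0 ρ) := fun z hz =>
    ((hρ' z hz).1.deriv.inv (hρ' z hz).2).differentiableAt.differentiableWithinAt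
  obtain ⟨R, hrR, hRρ⟩ := exists_between hrρ
  exact ⟨R, hrR, l1Norm_taylorSeries_ne_top hdiff hRρ, l1Norm_taylorSeries_ne_top hdiff' hRρ,
    (seriesEval_taylorSeries hdiff).mono (Metric.ball_subset_ball hRρ.le)⟩

end InitialData

section TimeRegularity

/-- The mean value inequality on `I ∩ ball t δ`, uniformly for `ξ` near a point of `U`. -/
theorem tendstoLocallyUniformlyOn_slope {I : Set ℝ} (hI : Convex ℝ I) {U : Set ℂ}
    {f g : ℝ → ℂ → ℂ} (hderiv : ∀ t ∈ I, ∀ ξ ∈ U, HasDerivWithinAt (f · ξ) (g t ξ) I t)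
    {t : ℝ} (ht : t ∈ I) (hg : TendstoLocallyUniformlyOn g (g t) (𝓝[I] t) U) :
    TendstoLocallyUniformlyOn (fun (s : ℝ) (ξ : ℂ) => (f s ξ - f t ξ) / ((s - t : ℝ) : ℂ)) (g t)
      (𝓝[I \ {t}] t) U := by
  rw [Metric.tendstoLocallyUniformlyOn_iff] at hg ⊢
  intro ε hε ξ hξ
  obtain ⟨V, hV, hclose⟩ := hg (ε / 2) (half_pos hε) ξ hξ
  refine ⟨V ∩ U, inter_mem hV self_mem_nhdsWithin, ?_⟩
  obtain ⟨δ, hδ, hball⟩ := Metric.mem_nhdsWithin_iff.mp hclose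
  filter_upwards [mem_nhdsWithin_of_mem_nhds (Metric.ball_mem_nhds t hδ), self_mem_nhdsWithin]
    with s hsδ hs ζ hζ
  have hst : ((s - t : ℝ) : ℂ) ≠ 0 := Complex.ofReal_ne_zero.mpr (sub_ne_zero.mpr hs.2)
  have hmvt := ((convex_ball t δ).inter hI).norm_image_sub_le_of_norm_hasDerivWithin_le
    (f := fun τ => f τ ζ - (τ : ℂ) * g t ζ) (f' := fun τ => g τ ζ - 1 * g t ζ) (C := ε / 2)
    (fun τ hτ => ((hderiv τ hτ.2 ζ hζ.2).mono inter_subset_right).sub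
      (Complex.ofRealCLM.hasDerivAt.hasDerivWithinAt.mul_const _))
    (fun τ hτ => by
      rw [one_mul, ← dist_eq_norm, dist_comm]
      exact (hball hτ ζ hζ.1).le)
    ⟨Metric.mem_ball_self hδ, ht⟩ ⟨hsδ, hs.1⟩
  have hslope : g t ζ - (f s ζ - f t ζ) / ((s - t : ℝ) : ℂ) =
      -(f s ζ - s * g t ζ - (f t ζ - t * g t ζ)) / ((s - t : ℝ) : ℂ) := by
    rw [eq_div_iff hst, sub_mul, div_mul_cancel₀ _ hst]
    push_cast
    ring
  rw [dist_eq_norm, hslope, norm_div, norm_neg, Complex.norm_real,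
    div_lt_iff₀ (norm_pos_iff.mpr (sub_ne_zero.mpr hs.2))]
  exact hmvt.trans_lt (mul_lt_mul_of_pos_right (half_lt_self hε)
    (norm_pos_iff.mpr (sub_ne_zero.mpr hs.2)))

theorem tendstoUniformlyOn_of_norm_sub_le {T X E : Type*} [PseudoMetricSpace T]
    [SeminormedAddCommGroup E] {I : Set T} {U : Set X} {t : T} {L : ℝ} {g : T → X → E}
    {g₀ : X → E} (h : ∀ s ∈ I, ∀ ξ ∈ U, ‖g s ξ - g₀ ξ‖ ≤ L * dist s t) :
    TendstoUniformlyOn g g₀ (𝓝[I] t) U := by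
  have hlim : Tendsto (fun s => L * dist s t) (𝓝[I] t) (𝓝 0) := by
    have hcont : Continuous fun s => L * dist s t := by fun_prop
    simpa using (hcont.tendsto t).mono_left nhdsWithin_le_nhds
  rw [Metric.tendstoUniformlyOn_iff]
  intro ε hε
  filter_upwards [hlim.eventually_lt_const hε, self_mem_nhdsWithin] with s hlt hs ξ hξ
  rw [dist_comm, dist_eq_norm]
  exact (h s hs ξ hξ).trans_lt hlt

end TimeRegularity

section Solution

theorem pos_of_continuousOn_of_ne_zero {u : ℝ → ℝ} {a b : ℝ} (hab : a ≤ b)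
    (hu : ContinuousOn u (Icc a b)) (ha : 0 < u a) (hne : ∀ t ∈ Icc a b, u t ≠ 0) : 0 < u b := by
  by_contra! hb
  obtain ⟨t, ht, hzero⟩ := intermediate_value_Icc' hab hu ⟨hb, ha.le⟩
  exact hne t ht hzero

theorem eq_of_derivative_eq_mul {A : Type*} [CommRing A] [IsAddTorsionFree A] {φ ψ ω σ : A⟦X⟧}
    (hφ : d⁄dX A φ = σ * φ) (hψ : d⁄dX A ψ = σ * ψ) (hφω : φ * ω = 1)
    (h₀ : PowerSeries.constantCoeff φ = PowerSeries.constantCoeff ψ) : φ = ψ := by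
  have hω : φ * d⁄dX A ω + ω * (σ * φ) = 0 := by
    simpa [hφ] using congrArg (d⁄dX A) hφω
  have hratio : ψ * ω = 1 := by
    refine PowerSeries.derivative.ext ?_ ?_
    · rw [Derivation.leibniz, smul_eq_mul, smul_eq_mul, hψ, Derivation.map_one_eq_zero]
      linear_combination ψ * ω * hω - (ψ * d⁄dX A ω + ω * (σ * ψ)) * hφω
    · rw [map_mul, ← h₀, ← map_mul, hφω]
  linear_combination ψ * hφω - φ * hratio

theorem derivative_map {A B : Type*} [CommSemiring A] [CommSemiring B] (e : A →+* B) (u : A⟦X⟧) :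
    d⁄dX B (u.map e) = (d⁄dX A u).map e := PowerSeries.ext fun n => by
  simp [PowerSeries.coeff_derivative]

/-- A formal solution of `f_t = ξ f' P[1 / |f'|²]` that converges for `|ξ| ≤ s` and `|t| ≤ τ` and
has initial data normalized by `f(0, 0) = 0` and `f'(0, 0) > 0`. The reciprocal `w = 1 / f'` is
carried along because the right-hand side is a power series expression in `w`. -/
structure IsConvergentSolution (s τ : ℝ≥0) (f w : ℂ⟦X⟧⟦X⟧) : Prop where
  xiDeriv_mul : xiDeriv f * w = 1
  derivative_eq : d⁄dX ℂ⟦X⟧ f = speedSeries w * xiDeriv f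
  l1Norm_ne_top : l1Norm (l1Norm enorm s) τ f ≠ ∞
  l1Norm_reciprocal_ne_top : l1Norm (l1Norm enorm s) τ w ≠ ∞
  coeff_zero : PowerSeries.coeff 0 (PowerSeries.coeff 0 f) = 0
  coeff_zero_xiDeriv_pos :
    ∃ a : ℝ, 0 < a ∧ PowerSeries.coeff 0 (PowerSeries.coeff 0 (xiDeriv f)) = a

variable {s τ t₀ : ℝ≥0} {f w : ℂ⟦X⟧⟦X⟧} {ξ : ℂ} {t : ℝ}

theorem l1Norm_l1Norm_mono_radius {s' : ℝ≥0} (h : s ≤ s') (τ : ℝ≥0) (x : ℂ⟦X⟧⟦X⟧) :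
    l1Norm (l1Norm enorm s) τ x ≤ l1Norm (l1Norm enorm s') τ x :=
  ENNReal.tsum_le_tsum fun n => by
    gcongr
    exact l1Norm_mono_radius enorm h _

theorem nnnorm_ofReal_le_of_mem_Icc (ht : t ∈ Icc (0 : ℝ) t₀) : ‖(t : ℂ)‖₊ ≤ t₀ := by
  rw [← NNReal.coe_le_coe, coe_nnnorm, Complex.norm_real, Real.norm_of_nonneg ht.1]
  exact ht.2

theorem nnnorm_le_one_of_mem_closedBall (hξ : ξ ∈ Metric.closedBall (0 : ℂ) 1) : ‖ξ‖₊ ≤ 1 :=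
  mem_closedBall_zero_iff.mp hξ

theorem analyticOnNhd_jointEval {x : ℂ⟦X⟧⟦X⟧} (hτ : 0 < τ)
    (hx : l1Norm (l1Norm enorm s) τ x ≠ ∞) {t : ℂ} (ht : ‖t‖₊ ≤ τ) :
    AnalyticOnNhd ℂ (fun ξ => jointEval x ξ t) (Metric.ball 0 s) :=
  DifferentiableOn.analyticOnNhd (fun _ hz => (hasDerivAt_jointEval_xi hτ hx
    (mem_ball_zero_iff.mp hz) ht).differentiableAt.differentiableWithinAt) Metric.isOpen_ball

namespace IsConvergentSolution

theorem jointEval_xiDeriv_mul (h : IsConvergentSolution s τ f w) (hτ : 0 < τ) (hξ : ‖ξ‖₊ < s)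
    {t : ℂ} (ht : ‖t‖₊ ≤ τ) : jointEval (xiDeriv f) ξ t * jointEval w ξ t = 1 := by
  have hw := ne_top_of_le_ne_top h.l1Norm_reciprocal_ne_top (l1Norm_l1Norm_mono_radius hξ.le τ w)
  rw [← jointEval_mul hτ (l1Norm_xiDeriv_ne_top hξ h.l1Norm_ne_top) hw le_rfl ht, h.xiDeriv_mul,
    ← map_one PowerSeries.C, jointEval_C, ← map_one PowerSeries.C, seriesEval_C]

theorem jointEval_xiDeriv_ne_zero (h : IsConvergentSolution s τ f w) (hτ : 0 < τ)
    (hξ : ‖ξ‖₊ < s) {t : ℂ} (ht : ‖t‖₊ ≤ τ) : jointEval (xiDeriv f) ξ t ≠ 0 :=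
  left_ne_zero_of_mul_eq_one (h.jointEval_xiDeriv_mul hτ hξ ht)

theorem hasDerivAt_xi (h : IsConvergentSolution s τ f w) (hτ : 0 < τ) (hξ : ‖ξ‖₊ < s) {t : ℂ}
    (ht : ‖t‖₊ ≤ τ) :
    HasDerivAt (fun ξ => jointEval f ξ t) (jointEval (xiDeriv f) ξ t) ξ :=
  hasDerivAt_jointEval_xi hτ h.l1Norm_ne_top hξ ht

theorem jointEval_derivative_eq (h : IsConvergentSolution s τ f w) (hs : 1 ≤ s) (hτ : 0 < τ)
    (hξ : ‖ξ‖₊ < s) {t : ℂ} (ht : ‖t‖₊ ≤ τ) : jointEval (d⁄dX ℂ⟦X⟧ f) ξ t =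
      ξ * (jointEval (schwarzSeries w) ξ t * jointEval (xiDeriv f) ξ t) := by
  have hS := ne_top_of_le_ne_top (l1Norm_schwarzSeries_ne_top hs h.l1Norm_reciprocal_ne_top)
    (l1Norm_l1Norm_mono_radius hξ.le τ _)
  rw [h.derivative_eq, speedSeries, mul_assoc, jointEval_C_X_mul,
    jointEval_mul hτ hS (l1Norm_xiDeriv_ne_top hξ h.l1Norm_ne_top) le_rfl ht]

theorem jointEval_derivative_eq_pgRHS (h : IsConvergentSolution s τ f w) (hs : 1 < s) (hτ : 0 < τ)
    (hξ : ξ ∈ Metric.ball (0 : ℂ) 1) (ht : ‖(t : ℂ)‖₊ ≤ τ) :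
    jointEval (d⁄dX ℂ⟦X⟧ f) ξ t = pgRHS (fun ξ => jointEval f ξ t) ξ := by
  have hlt : ∀ z ∈ Metric.closedBall (0 : ℂ) 1, ‖z‖₊ < s := fun z hz =>
    (nnnorm_le_one_of_mem_closedBall hz).trans_lt hs
  have hξs := hlt ξ (Metric.ball_subset_closedBall hξ)
  have hreciprocal : EqOn
      (fun z => ((1 / ‖deriv (fun ξ => jointEval f ξ t) z‖ ^ 2 : ℝ) : ℂ))
      (fun z => ((‖jointEval w z t‖ ^ 2 : ℝ) : ℂ)) (Metric.sphere 0 1) := fun z hz => by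
    have hz' := hlt z (Metric.sphere_subset_closedBall hz)
    simp only [(h.hasDerivAt_xi hτ hz' ht).deriv, one_div, ← inv_pow, ← norm_inv,
      ← eq_inv_of_mul_eq_one_right (h.jointEval_xiDeriv_mul hτ hz' ht)]
  rw [pgRHS, schwarzP_congr hreciprocal,
    schwarzP_norm_jointEval_sq hs hτ h.l1Norm_reciprocal_ne_top ht hξ,
    (h.hasDerivAt_xi hτ hξs ht).deriv, h.jointEval_derivative_eq hs.le hτ hξs ht]
  ring

theorem jointEval_zero (h : IsConvergentSolution s τ f w) (t : ℂ) : jointEval f 0 t = 0 := by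
  have hzero : xiEval 0 f = 0 := by
    refine PowerSeries.derivative.ext ?_ ?_
    · rw [← xiEval_derivative, h.derivative_eq, speedSeries, xiEval_zero_left]
      simp
    · rw [← PowerSeries.coeff_zero_eq_constantCoeff_apply, coeff_xiEval, seriesEval_zero_right,
        h.coeff_zero, map_zero]
  simp [jointEval, hzero, seriesEval]

theorem derivative_xiEval_zero_xiDeriv (h : IsConvergentSolution s τ f w) :
    d⁄dX ℂ (xiEval 0 (xiDeriv f)) = xiEval 0 (schwarzSeries w) * xiEval 0 (xiDeriv f) := by
  have hX : xiDeriv (PowerSeries.C PowerSeries.X) = 1 := PowerSeries.ext fun n => by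
    rw [coeff_coeffwiseDerivation, PowerSeries.coeff_C, PowerSeries.coeff_one]
    split_ifs <;> simp
  rw [← xiEval_derivative, ← coeffwiseDerivation_derivative, h.derivative_eq, speedSeries]
  simp [xiEval_zero_left, hX, mul_comm]

/-- Both sides solve `φ' = σ φ` with `σ = P[|w|²](0)`, whose coefficients are real. -/
theorem map_conj_xiEval_zero_xiDeriv (h : IsConvergentSolution s τ f w) :
    (xiEval 0 (xiDeriv f)).map (starRingEnd ℂ) = xiEval 0 (xiDeriv f) := by
  obtain ⟨a, -, ha⟩ := h.coeff_zero_xiDeriv_pos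
  refine (eq_of_derivative_eq_mul (ω := xiEval 0 w) h.derivative_xiEval_zero_xiDeriv ?_ ?_ ?_).symm
  · rw [derivative_map, h.derivative_xiEval_zero_xiDeriv, map_mul,
      map_conj_xiEval_schwarzSeries_zero]
  · rw [xiEval_zero_left, xiEval_zero_left, ← map_mul, h.xiDeriv_mul, map_one]
  · rw [← PowerSeries.coeff_zero_eq_constantCoeff_apply,
      ← PowerSeries.coeff_zero_eq_constantCoeff_apply, PowerSeries.coeff_map, coeff_xiEval,
      seriesEval_zero_right, ha, Complex.conj_ofReal]

theorem jointEval_xiDeriv_zero_pos (h : IsConvergentSolution s τ f w) (hs : 0 < s)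
    (ht : t ∈ Ico (0 : ℝ) τ) : ∃ a : ℝ, 0 < a ∧ jointEval (xiDeriv f) 0 t = a := by
  have hreal : ∀ t : ℝ, ((jointEval (xiDeriv f) 0 t).re : ℂ) = jointEval (xiDeriv f) 0 t :=
    fun t => Complex.conj_eq_iff_re.mp <| by
      rw [jointEval, conj_seriesEval, h.map_conj_xiEval_zero_xiDeriv, Complex.conj_ofReal]
  refine ⟨_, ?_, (hreal t).symm⟩
  have hlt : ∀ x ∈ Icc 0 t, ‖(x : ℂ)‖₊ < τ := fun x hx => by
    rw [← NNReal.coe_lt_coe, coe_nnnorm, Complex.norm_real, Real.norm_of_nonneg hx.1]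
    exact hx.2.trans_lt ht.2
  have hτ : 0 < τ := NNReal.coe_pos.mp (ht.1.trans_lt ht.2)
  have h0 : ‖(0 : ℂ)‖₊ < s := by rwa [nnnorm_zero]
  have hxi := l1Norm_xiDeriv_ne_top h0 h.l1Norm_ne_top
  refine pos_of_continuousOn_of_ne_zero (u := fun x => (jointEval (xiDeriv f) 0 x).re) ht.1
    (fun x hx => ?_) ?_ fun x hx hx0 => ?_
  · exact (Complex.continuous_re.continuousAt.comp ((hasDerivAt_jointEval_time hxi le_rfl
      (hlt x hx)).continuousAt.comp Complex.continuous_ofReal.continuousAt)).continuousWithinAt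
  · obtain ⟨a, ha, hfa⟩ := h.coeff_zero_xiDeriv_pos
    rwa [Complex.ofReal_zero, jointEval_zero_time, seriesEval_zero_right, hfa, Complex.ofReal_re]
  · refine h.jointEval_xiDeriv_ne_zero hτ h0 (hlt x hx).le ?_
    rw [← hreal, hx0, Complex.ofReal_zero]

theorem memOmega (h : IsConvergentSolution s τ f w) (hs : 0 < s) (ht : t ∈ Ico (0 : ℝ) τ)
    {E : Set ℂ} (hE : E ⊆ Metric.ball 0 s) : MemOmega E fun ξ => jointEval f ξ t := by
  have hτ : 0 < τ := NNReal.coe_pos.mp (ht.1.trans_lt ht.2)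
  have htτ := nnnorm_ofReal_le_of_mem_Icc (Ico_subset_Icc_self ht)
  have hlt : ∀ z ∈ E, ‖z‖₊ < s := fun z hz => mem_ball_zero_iff.mp (hE hz)
  have hf := analyticOnNhd_jointEval hτ h.l1Norm_ne_top htτ
  refine ⟨hf.mono hE, fun z hz => exists_injOn_of_deriv_ne_zero (hf z (hE hz)) ?_,
    h.jointEval_zero t, ?_⟩
  · rw [(h.hasDerivAt_xi hτ (hlt z hz) htτ).deriv]
    exact h.jointEval_xiDeriv_ne_zero hτ (hlt z hz) htτ
  · rw [(h.hasDerivAt_xi hτ (by rwa [nnnorm_zero]) htτ).deriv]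
    exact h.jointEval_xiDeriv_zero_pos hs ht

theorem hasDerivWithinAt_time (h : IsConvergentSolution s τ f w) (ht₀ : t₀ < τ)
    (ht : t ∈ Icc (0 : ℝ) t₀) (hξ : ‖ξ‖₊ ≤ s) (I : Set ℝ) :
    HasDerivWithinAt (fun t : ℝ => jointEval f ξ t) (jointEval (d⁄dX ℂ⟦X⟧ f) ξ t) I t :=
  (hasDerivAt_jointEval_time h.l1Norm_ne_top hξ
    ((nnnorm_ofReal_le_of_mem_Icc ht).trans_lt ht₀)).comp_ofReal.hasDerivWithinAt

theorem contDiffOn_time (h : IsConvergentSolution s τ f w) (ht₀ : t₀ < τ) (hξ : ‖ξ‖₊ ≤ s) :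
    ContDiffOn ℝ 1 (fun t : ℝ => jointEval f ξ t) (Icc 0 t₀) := by
  have hdiff : DifferentiableOn ℂ (jointEval f ξ) (Metric.ball 0 τ) := fun t ht =>
    (hasDerivAt_jointEval_time h.l1Norm_ne_top hξ
      (mem_ball_zero_iff.mp ht)).differentiableAt.differentiableWithinAt
  refine ((hdiff.contDiffOn Metric.isOpen_ball).restrict_scalars ℝ).comp
    Complex.ofRealCLM.contDiff.contDiffOn fun t ht => mem_ball_zero_iff.mpr ?_
  exact (nnnorm_ofReal_le_of_mem_Icc ht).trans_lt ht₀

theorem isStrongStarSolution (h : IsConvergentSolution s τ f w) (hs : 1 < s) (ht₀ : t₀ < τ) :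
    IsStrongStarSolution (Icc 0 t₀) fun t ξ => jointEval f ξ t where
  memOmega t ht := h.memOmega (one_pos.trans hs)
    (Icc_subset_Ico_right (NNReal.coe_lt_coe.mpr ht₀) ht) (Metric.closedBall_subset_ball hs)
  contDiffOn ξ hξ := h.contDiffOn_time ht₀ ((nnnorm_le_one_of_mem_closedBall hξ).trans hs.le)
  equation t ht ξ hξ := by
    rw [← h.jointEval_derivative_eq_pgRHS hs (pos_of_gt ht₀) hξ
      ((nnnorm_ofReal_le_of_mem_Icc ht).trans ht₀.le)]
    exact h.hasDerivWithinAt_time ht₀ ht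
      ((nnnorm_le_one_of_mem_closedBall (Metric.ball_subset_closedBall hξ)).trans hs.le) _

theorem isC1Holomorphic (h : IsConvergentSolution s τ f w) (ht₀ : t₀ < τ) {U : Set ℂ}
    (hU : U ⊆ Metric.ball 0 s) : IsC1Holomorphic (Icc 0 t₀) U fun t ξ => jointEval f ξ t := by
  obtain ⟨τ', ht₀', hτ'⟩ := exists_between ht₀
  have hf' := l1Norm_derivative_ne_top (isSubmulSeminorm_l1Norm_enorm s) hτ' h.l1Norm_ne_top
  have ht : ∀ t ∈ Icc (0 : ℝ) t₀, ‖(t : ℂ)‖₊ ≤ t₀ := fun t => nnnorm_ofReal_le_of_mem_Icc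
  have hlt : ∀ ξ ∈ U, ‖ξ‖₊ < s := fun ξ hξ => mem_ball_zero_iff.mp (hU hξ)
  obtain ⟨L, hL⟩ := exists_lipschitz_jointEval ht₀' hf'
  have hcont : ∀ t ∈ Icc (0 : ℝ) t₀, TendstoLocallyUniformlyOn
      (fun (t : ℝ) ξ => jointEval (d⁄dX ℂ⟦X⟧ f) ξ t) (fun ξ => jointEval (d⁄dX ℂ⟦X⟧ f) ξ t)
      (𝓝[Icc 0 ↑t₀] t) U := fun t htI =>
    (tendstoUniformlyOn_of_norm_sub_le fun t' ht' ξ hξ => by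
      simpa only [← Complex.ofReal_sub, Complex.norm_real, ← dist_eq_norm] using
        hL ξ t t' (hlt ξ hξ).le (ht t htI) (ht t' ht')).tendstoLocallyUniformlyOn
  exact ⟨fun t htI => (analyticOnNhd_jointEval (pos_of_gt ht₀) h.l1Norm_ne_top
      ((ht t htI).trans ht₀.le)).mono hU,
    fun t ξ => jointEval (d⁄dX ℂ⟦X⟧ f) ξ t,
    fun t htI => (analyticOnNhd_jointEval (pos_of_gt ht₀') hf'
      ((ht t htI).trans ht₀'.le)).mono hU,
    fun t htI => tendstoLocallyUniformlyOn_slope (convex_Icc _ _)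
      (fun t htI ξ hξ => h.hasDerivWithinAt_time ht₀ htI (hlt ξ hξ).le _) htI (hcont t htI),
    hcont⟩

end IsConvergentSolution

end Solution

end PolubarinovaGalin

open PolubarinovaGalin

theorem mainTheorem6 (r ρ₀ : ℝ) (hr : 1 < r) (hρ : r < ρ₀) (f₀ : ℂ → ℂ)
    (hω : MemOmega (Metric.closedBall 0 r) f₀)
    (hH : AnalyticOnNhd ℂ f₀ (Metric.closedBall 0 ρ₀)) :
    ∃ t₀ : ℝ, 0 < t₀ ∧ ∃ f : ℝ → ℂ → ℂ,
      IsStrongStarSolution (Icc 0 t₀) f ∧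
      IsC1Holomorphic (Icc 0 t₀) (Metric.ball 0 r) f ∧
      (∀ t ∈ Icc 0 t₀, MemOmega (Metric.ball 0 r) (f t)) ∧
      EqOn (f 0) f₀ (Metric.ball 0 r) := by
  lift r to ℝ≥0 using zero_le_one.trans hr.le
  obtain ⟨a, ha, hfa⟩ := hω.deriv_zero_pos
  have hd : deriv f₀ 0 ≠ 0 := hfa ▸ Complex.ofReal_ne_zero.mpr ha.ne'
  obtain ⟨R, hrR, hF, hW, hFf₀⟩ := exists_l1Norm_taylorSeries_ne_top hω.analytic hω.locallyUnivalent
  obtain ⟨f, w, hf0, hw0, hfw, hf, hw⟩ := exists_formal_solution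
    (derivative_taylorSeries_mul_taylorSeries_inv
      (hω.analytic 0 (Metric.mem_closedBall_self r.coe_nonneg)) hd)
  obtain ⟨s, hrs, hsR⟩ := exists_between hrR
  have hs : 1 < s := lt_trans (by exact_mod_cast hr) hrs
  obtain ⟨τ, hτ, hfs, hws⟩ := exists_l1Norm_formal_solution_ne_top hs.le hsR hf hw
    (hf0 ▸ hF) (hw0 ▸ hW)
  have hsol : IsConvergentSolution s τ f w := ⟨hfw, hf, hfs, hws,
    by rw [hf0, coeff_zero_taylorSeries, hω.map_zero],
    a, ha, by rw [coeff_coeffwiseDerivation, hf0, derivative_taylorSeries,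
      coeff_zero_taylorSeries, hfa]⟩
  have hball : Metric.ball (0 : ℂ) r ⊆ Metric.ball 0 s := Metric.ball_subset_ball hrs.le
  obtain ⟨t₀, ht₀, ht₀τ⟩ := exists_between hτ
  refine ⟨t₀, ht₀, fun t ξ => jointEval f ξ t, hsol.isStrongStarSolution hs ht₀τ,
    hsol.isC1Holomorphic ht₀τ hball, fun t ht => hsol.memOmega (one_pos.trans hs)
      (Icc_subset_Ico_right (NNReal.coe_lt_coe.mpr ht₀τ) ht) hball, fun ξ hξ => ?_⟩
  simp only [Complex.ofReal_zero, jointEval_zero_time, hf0]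
  exact hFf₀ (Metric.ball_subset_ball hrR.le hξ)
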